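/- **Setting.** Let $n$ treatments $d^1,\dots,d^n$ be given and fix $i$. Individual $m\in\mathbb N$ has covariates $\mathbf Z_m$ (in a measurable space), a factual treatment $D_m\in\{d^1,\dots,d^n\}$, and factual and counterfactual noise terms $\xi^{j;F}_m,\xi^{j;CF}_m$; the outcome under $d^j$ is $Y^j_m=g^j(\mathbf Z_m)+\xi^{j;F}_m$ if $D_m=d^j$ and $Y^j_m=g^j(\mathbf Z_m)+\xi^{j;CF}_m$ otherwise, and the observation is $(Y_m,D_m,\mathbf Z_m)$, where $Y_m$ is the outcome under the factual treatment. All functions are measurable and the individuals are independent and identically distributed. Let $\nu^i=\mathbf 1_{\{D=d^i\}}-\pi^i(\mathbf Z)$. Assume $\mathbb E[\nu^i\mid\mathbf Z]=0$; $g^i(\mathbf Z)$ is integrable; $\xi^{i;F},\xi^{i;CF}$ are square integrable, identically distributed, have conditional expectation $0$ given $\mathbf Z$, and each of them is independent of $\mathbf Z$ and is independent of $\nu^i$. Put $\theta^i=\mathbb E[g^i(\mathbf Z)]$. Let $2\le k\le r$ be integers with $\mathbb E[(\nu^i)^r]\ne0$. For a function $a$ put $$A(D,\mathbf Z;a)=\bar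 b_r[\mathbf 1_{\{D=d^i\}}-a(\mathbf Z)]^r+\sum_{q=1}^{k-1}b_q\big([\mathbf 1_{\{D=d^i\}}-a(\mathbf Z)]^q-\mathbb E[(\nu^i)^q]\big),$$ where $\bar b_r=1/\mathbb E[(\nu^i)^r]$ and, for $q=k-1,k-2,\dots,1$, $$b_q=-\sum_{u=1}^{k-1-q}b_{q+u}\binom{q+u}{q}\mathbb E[(\nu^i)^u]-\bar b_r\binom rq\mathbb E[(\nu^i)^{r-q}].$$ The score is $\psi(W,\vartheta,(x,a))=\vartheta-x(\mathbf Z)-(Y^i-x(\mathbf Z))A(D,\mathbf Z;a)$, and $\mathbf D^\alpha\psi$, $\alpha=(\alpha_1,\alpha_2)\in\mathbb N^2$, denotes its partial derivative of order $\alpha_1$ in the value $x(\mathbf Z)$ and $\alpha_2$ in the value $a(\mathbf Z)$; $|\alpha|=\alpha_1+\alpha_2$. **Estimator.** For each $N$ let $\mathcal I=\mathcal I_N$ and $\mathcal I^c=\mathcal I^c_N$ be disjoint finite sets of individuals with $|\mathcal I_N|=N$, and let $\hat g^i=\hat g^i_N$, $\hat\pi^i=\hat\pi^i_N$ be functions trained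 (jointly measurably) on the observations in $\mathcal I^c$. Let $\mathfrak D_i$ be the set of individuals with $D_m=d^i$, and $R=R_N\ge1$ (for instance constant). Given the data in $\mathcal I\cup\mathcal I^c$, whenever $\mathfrak D_i\cap\mathcal I\neq\emptyset$, let $J_{m,u}$ ($m\in\mathcal I$, $1\le u\le R$) be independent uniform picks (with replacement) from $\mathfrak D_i\cap\mathcal I$, and let $\hat\xi^{i;F}_{m,u}=Y_{J_{m,u}}-\hat g^i(\mathbf Z_{J_{m,u}})$. Put $$\hat\theta^i_N=\frac1N\sum_{m\in\mathcal I}\hat g^i(\mathbf Z_m)+\frac1N\sum_{m\in\mathfrak D_i\cap\mathcal I}(Y_m-\hat g^i(\mathbf Z_m))A(D_m,\mathbf Z_m;\hat\pi^i)+\frac1R\sum_{u=1}^R\Big[\frac1N\sum_{m\in\mathfrak D_i^c\cap\mathcal I}\hat\xi^{i;F}_{m,u}A(D_m,\mathbf Z_m;\hat\pi^i)\Big].$$ **Conditions of Mackey et al.** Let $\mathcal T$ be a set of pairs of functions that contains $(g^i,\pi^i)$ and, for every $N$, almost surely $(\hat g^i_N,\hat\pi^i_N)$. 1. (First stage consistency)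 For every $\alpha$ with $1\le|\alpha|\le k$, $\mathbb E\big[|\hat g^i_N(\mathbf Z)-g^i(\mathbf Z)|^{4\alpha_1}|\hat\pi^i_N(\mathbf Z)-\pi^i(\mathbf Z)|^{4\alpha_2}\mid\hat g^i_N,\hat\pi^i_N\big]\to0$ in probability, where $\mathbf Z$ is independent of $(\hat g^i_N,\hat\pi^i_N)$. 2. (Regularity of moments) There are $\rho>0$ and $B<\infty$ such that $\mathbb E|\mathbf D^\alpha\psi(W,\theta^i,(x,a))|^4\le B$ for all $|\alpha|\le k+1$ and all measurable $(x,a)\in\mathcal T$ with $\mathbb E\big[|x(\mathbf Z)-g^i(\mathbf Z)|^{2\beta_1}|a(\mathbf Z)-\pi^i(\mathbf Z)|^{2\beta_2}\big]\le\rho$ for all $1\le|\beta|\le k+1$. **Claim.** The estimator is consistent: $\hat\theta^i_N\to\theta^i$ in probability as $N\to\infty$. The same holds if each moment $\mathbb E[(\nu^i)^q]$ in $A$ and its coefficients is replaced by its estimate $\frac1N\sum_{m\in\mathcal I}(\mathbf 1_{\{D_m=d^i\}}-\hat\pi^i(\mathbf Z_m))^q$. -/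

import Mathlib

open MeasureTheory ProbabilityTheory Filter
open scoped ENNReal NNReal Topology

noncomputable section

/-! ### The weight `A` and the score function -/

/-- The coefficients `b_q`, computed in descending order of `q ≤ k - 1` from the moments
`mom u = E[ν ^ u]`:
`b_q = - ∑_{u=1}^{k-1-q} b_{q+u} (q+u choose q) E[ν^u] - b̄_r (r choose q) E[ν^{r-q}]`,
with `b̄_r = 1 / E[ν^r]`. The summation index below is `u - 1`. -/
def coeffB (mom : ℕ → ℝ) (r k : ℕ) (q : ℕ) : ℝ :=
  - (∑ u : Fin (k - 1 - q),
      coeffB mom r k (q + (u.val + 1)) * ((q + (u.val + 1)).choose q : ℝ) * mom (u.val + 1))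
    - (mom r)⁻¹ * (r.choose q : ℝ) * mom (r - q)
termination_by k - 1 - q
decreasing_by
  have := u.isLt
  omega

/-- `A(D, Z; a)`, where `δ` is the value of `1_{D = dⁱ}` and `a` the value of `a(Z)`. -/
def weightA (mom : ℕ → ℝ) (r k : ℕ) (δ a : ℝ) : ℝ :=
  (mom r)⁻¹ * (δ - a) ^ r
    + ∑ q ∈ Finset.Icc 1 (k - 1), coeffB mom r k q * ((δ - a) ^ q - mom q)

/-- The score `ψ = ϑ - x - (y - x) A(D, Z; a)`, where `y`, `δ`, `x`, `a` are the values of `Yⁱ`,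
`1_{D = dⁱ}` and of the two nuisance parameters at `Z`. -/
def scoreFn (mom : ℕ → ℝ) (r k : ℕ) (ϑ y δ x a : ℝ) : ℝ :=
  ϑ - x - (y - x) * weightA mom r k δ a

/-- The `α`-differential of the score with respect to the two nuisance values. -/
def scoreDiff (mom : ℕ → ℝ) (r k : ℕ) (α : ℕ × ℕ) (ϑ y δ x a : ℝ) : ℝ :=
  iteratedDeriv α.1
    (fun x' => iteratedDeriv α.2 (fun a' => scoreFn mom r k ϑ y δ x' a') a) x

/-! ### The causal model -/

/-- The random variables and functions of the model with `n` treatments; `m : ℕ` numbers the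
individuals. `ξF j m` and `ξCF j m` are the noise terms of the outcome of individual `m` under the
treatment `j`, in case `j` is its factual treatment, respectively is not. -/
structure CausalModel (Ω 𝒵 : Type*) (n : ℕ) where
  /-- covariates -/
  Z : ℕ → Ω → 𝒵
  /-- factual treatments -/
  D : ℕ → Ω → Fin n
  /-- outcome regression functions -/
  g : Fin n → 𝒵 → ℝ
  /-- propensity scores -/
  prop : Fin n → 𝒵 → ℝ
  /-- factual noise -/
  ξF : Fin n → ℕ → Ω → ℝ
  /-- counterfactual noise -/
  ξCF : Fin n → ℕ → Ω → ℝ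

namespace CausalModel

variable {Ω 𝒵 : Type*} {n : ℕ} (M : CausalModel Ω 𝒵 n)

/-- `1_{D_m = dⁱ}` -/
def treated (i : Fin n) (m : ℕ) (ω : Ω) : ℝ := if M.D m ω = i then 1 else 0

/-- `νⁱ = 1_{D = dⁱ} - πⁱ(Z)` -/
def ν (i : Fin n) (m : ℕ) (ω : Ω) : ℝ := M.treated i m ω - M.prop i (M.Z m ω)

/-- The outcome `Yⁱ` of individual `m` under the treatment `i`. -/
def outcome (i : Fin n) (m : ℕ) (ω : Ω) : ℝ :=
  M.g i (M.Z m ω) + if M.D m ω = i then M.ξF i m ω else M.ξCF i m ω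

/-- The observed outcome: the one under the factual treatment. -/
def observed (m : ℕ) (ω : Ω) : ℝ := M.outcome (M.D m ω) m ω

/-- The observation `(Y_m, D_m, Z_m)`. -/
def obs (m : ℕ) (ω : Ω) : ℝ × Fin n × 𝒵 := (M.observed m ω, M.D m ω, M.Z m ω)

/-- All the random variables of individual `m`. -/
def individual (m : ℕ) (ω : Ω) : 𝒵 × Fin n × (Fin n → ℝ) × (Fin n → ℝ) :=
  (M.Z m ω, M.D m ω, fun j => M.ξF j m ω, fun j => M.ξCF j m ω)

variable [MeasurableSpace Ω] [MeasurableSpace 𝒵]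

/-- The causal parameter `θⁱ = E[gⁱ(Z)]`. -/
def θ (μ : Measure Ω) (i : Fin n) : ℝ := ∫ ω, M.g i (M.Z 0 ω) ∂μ

/-- The moments `E[(νⁱ)^q]`. -/
def moment (μ : Measure Ω) (i : Fin n) (q : ℕ) : ℝ := ∫ ω, M.ν i 0 ω ^ q ∂μ

/-- The assumptions of the model that concern the treatment `i`. -/
structure Valid (μ : Measure Ω) (i : Fin n) : Prop where
  measurable_Z : ∀ m, Measurable (M.Z m)
  measurable_D : ∀ m, Measurable (M.D m)
  measurable_g : ∀ j, Measurable (M.g j)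
  measurable_prop : ∀ j, Measurable (M.prop j)
  measurable_ξF : ∀ j m, Measurable (M.ξF j m)
  measurable_ξCF : ∀ j m, Measurable (M.ξCF j m)
  /-- the individuals are independent and identically distributed -/
  indep : iIndepFun M.individual μ
  ident : ∀ m, IdentDistrib (M.individual m) (M.individual 0) μ μ
  integrable_g : Integrable (fun ω => M.g i (M.Z 0 ω)) μ
  /-- `E[νⁱ | Z] = 0`, that is, `πⁱ` is the propensity score -/
  integrable_ν : ∀ m, Integrable (M.ν i m) μ
  condExp_ν : ∀ m, μ[M.ν i m | MeasurableSpace.comap (M.Z m) inferInstance] =ᵐ[μ] 0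
  /-- the noise terms are square integrable -/
  memLp_ξF : ∀ m, MemLp (M.ξF i m) 2 μ
  memLp_ξCF : ∀ m, MemLp (M.ξCF i m) 2 μ
  condExp_ξF : ∀ m, μ[M.ξF i m | MeasurableSpace.comap (M.Z m) inferInstance] =ᵐ[μ] 0
  condExp_ξCF : ∀ m, μ[M.ξCF i m | MeasurableSpace.comap (M.Z m) inferInstance] =ᵐ[μ] 0
  ident_ξ : ∀ m, IdentDistrib (M.ξF i m) (M.ξCF i m) μ μ
  indep_ξF_Z : ∀ m, IndepFun (M.ξF i m) (M.Z m) μ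
  indep_ξCF_Z : ∀ m, IndepFun (M.ξCF i m) (M.Z m) μ
  indep_ξF_ν : ∀ m, IndepFun (M.ξF i m) (M.ν i m) μ
  indep_ξCF_ν : ∀ m, IndepFun (M.ξCF i m) (M.ν i m) μ

/-! ### The conditions on the nuisance parameters -/

/-- `E[|x(Z) - gⁱ(Z)|^{p₁} |a(Z) - πⁱ(Z)|^{p₂}]` for fixed functions `x` and `a`. -/
def nuisanceError (μ : Measure Ω) (i : Fin n) (p : ℕ × ℕ) (x a : 𝒵 → ℝ) : ℝ≥0∞ :=
  ∫⁻ z, ‖x z - M.g i z‖ₑ ^ p.1 * ‖a z - M.prop i z‖ₑ ^ p.2 ∂(μ.map (M.Z 0))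

/-- Consistency of the first stage: for all `α` with `1 ≤ |α| ≤ k`,
`E[|ĝ(Z) - gⁱ(Z)|^{4α₁} |π̂(Z) - πⁱ(Z)|^{4α₂} | ĝ, π̂] → 0` in probability, the expectation being
over a copy of `Z` that is independent of the estimated functions. -/
def FirstStageConsistent (μ : Measure Ω) (i : Fin n) (k : ℕ) (gHat πHat : ℕ → Ω → 𝒵 → ℝ) : Prop :=
  ∀ α : ℕ × ℕ, 1 ≤ α.1 + α.2 → α.1 + α.2 ≤ k → ∀ ε : ℝ≥0∞, 0 < ε →
    Tendsto (fun N => μ {ω | ε ≤ M.nuisanceError μ i (4 * α.1, 4 * α.2) (gHat N ω) (πHat N ω)})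
      atTop (𝓝 0)

/-- Regularity of the moments: in a neighbourhood of the authentic nuisance parameters within the
nuisance class `𝒯`, the differentials of the score up to order `k + 1` have uniformly bounded
fourth moments at the authentic causal parameter. -/
def MomentsRegular (μ : Measure Ω) (i : Fin n) (r k : ℕ) (𝒯 : Set ((𝒵 → ℝ) × (𝒵 → ℝ))) : Prop :=
  ∃ ρ : ℝ≥0∞, 0 < ρ ∧ ∃ B : ℝ≥0, ∀ h ∈ 𝒯, Measurable h.1 → Measurable h.2 →
    (∀ α : ℕ × ℕ, 1 ≤ α.1 + α.2 → α.1 + α.2 ≤ k + 1 →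
      M.nuisanceError μ i (2 * α.1, 2 * α.2) h.1 h.2 ≤ ρ) →
    ∀ α : ℕ × ℕ, α.1 + α.2 ≤ k + 1 →
      ∫⁻ ω, ‖scoreDiff (M.moment μ i) r k α (M.θ μ i) (M.outcome i 0 ω) (M.treated i 0 ω)
        (h.1 (M.Z 0 ω)) (h.2 (M.Z 0 ω))‖ₑ ^ 4 ∂μ ≤ B

/-! ### Resampling and the estimator -/

/-- `𝔇ᵢ ∩ I`: the individuals in `I` whose factual treatment is `i`. -/
def pool (i : Fin n) (I : Finset ℕ) (ω : Ω) : Finset ℕ := I.filter fun m => M.D m ω = i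

/-- `𝔇ᵢᶜ ∩ I` -/
def poolCompl (i : Fin n) (I : Finset ℕ) (ω : Ω) : Finset ℕ := I.filter fun m => M.D m ω ≠ i

/-- The σ-algebra generated by the observations in `S`. -/
@[reducible] def dataAlgebra (S : Finset ℕ) : MeasurableSpace Ω :=
  ⨆ m ∈ S, MeasurableSpace.comap (M.obs m) inferInstance

/-- Given the observational data in `S` with `𝔇ᵢ ∩ I` nonempty, the picks `J m u` for `m ∈ I` and
`u < R` are independent and uniformly distributed on `𝔇ᵢ ∩ I` (random picking with replacement). -/
structure IsResampling (μ : Measure Ω) (i : Fin n) (S I : Finset ℕ) (R : ℕ)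
    (J : ℕ → ℕ → Ω → ℕ) : Prop where
  measurable : ∀ m u, Measurable (J m u)
  uniform : ∀ (E : Set Ω) (P : Finset ℕ), MeasurableSet[M.dataAlgebra S] E → P.Nonempty →
    (∀ ω ∈ E, M.pool i I ω = P) →
    ∀ (F : Finset (ℕ × ℕ)) (j : ℕ × ℕ → ℕ), F ⊆ I ×ˢ Finset.range R → (∀ p ∈ F, j p ∈ P) →
      μ (E ∩ {ω | ∀ p ∈ F, J p.1 p.2 ω = j p}) = μ E * ((P.card : ℝ≥0∞)⁻¹) ^ F.card

/-- The estimator built from the sample `I`, estimated functions `x` and `a` of `gⁱ` and `πⁱ`,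
values `mom q` for the moments `E[(νⁱ)^q]`, and `R` rounds of picks `J m u`: the residual of
`m ∈ 𝔇ᵢᶜ ∩ I` in round `u` is replaced by the estimated factual residual of individual `J m u`. -/
def estimator (i : Fin n) (r k : ℕ) (I : Finset ℕ) (R : ℕ) (mom : ℕ → ℝ) (x a : 𝒵 → ℝ)
    (J : ℕ → ℕ → Ω → ℕ) (ω : Ω) : ℝ :=
  (1 / (I.card : ℝ)) * ∑ m ∈ I, x (M.Z m ω)
  + (1 / (I.card : ℝ)) * ∑ m ∈ M.pool i I ω,
      (M.observed m ω - x (M.Z m ω)) * weightA mom r k (M.treated i m ω) (a (M.Z m ω))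
  + (1 / (R : ℝ)) * ∑ u ∈ Finset.range R,
      ((1 / (I.card : ℝ)) * ∑ m ∈ M.poolCompl i I ω,
        (M.observed (J m u ω) ω - x (M.Z (J m u ω) ω))
          * weightA mom r k (M.treated i m ω) (a (M.Z m ω)))

/-- The estimates of the moments `E[(νⁱ)^q]` from the sample `I` by means of an estimated
propensity score `a`. -/
def empiricalMoment (i : Fin n) (I : Finset ℕ) (a : 𝒵 → ℝ) (ω : Ω) (q : ℕ) : ℝ :=
  (1 / (I.card : ℝ)) * ∑ m ∈ I, (M.treated i m ω - a (M.Z m ω)) ^ q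

/-- The function trained by the procedure `T` on the observations in `S`. -/
def trained {S : Finset ℕ} (T : (S → ℝ × Fin n × 𝒵) → 𝒵 → ℝ) (ω : Ω) : 𝒵 → ℝ :=
  T fun m => M.obs m ω

end CausalModel

end

/-! The weight `A` is a linear combination of powers of `1_D - π̂(Z)`, so the estimator is the
average of `ĝ` plus `(mom r)⁻¹ G_r + ∑ b_q (G_q - mom q * G_0)`, where `G_q` averages the residuals,
factual or resampled, weighted by the `q`-th power. It suffices that the average of `ĝ` tends to
`θ`, that `G_q → 0` in probability for every `q ≤ r`, and that the coefficients converge. The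
particular values of the `b_q` do not matter for this, and any consistent estimates of the moments
will do (`TrainedNuisance.tendsto_estimator`).

The factual part of `G_q` tends to `E[1_D ξF ν^q]`. This is zero although `ξF` is only independent
of `ν` and of `Z` separately: almost surely `1_D` equals `1_{ν > 0} + 1_{π(Z) = 1}`, so that `1_D
ν^q` splits into a function of `ν` and a function of `Z` (`Valid.integral_treated_mul_noise`).

Given the data, the resampled part is a weighted sum of independent uniform picks. By Chebyshev's
inequality it is close to the average untreated weight times the mean residual of the treated
(`IsResampling.measure_abs_sub_ge_le`). That mean residual tends to `E[1_D ξF] / P(D = i) = 0`; the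
denominator is positive because `E[ν^r] ≠ 0`.

These limits need a weak law for averages containing the trained functions. Individuals of `I` are
independent of the training data, so a conditional Markov inequality reduces the matter to `E|Φ(ĝ,
π̂) - Φ(g, π)| → 0`. Consistency makes the nuisance errors small in `L⁴`; what remains is a bound on
`|1_D - π̂|^r` in `L⁴`. It comes from the regularity condition for the first derivative in `x`,
which is `A - 1`: the leading power of `A` is controlled by `A - 1` and by lower powers
(`exists_pow_le_weightA`). -/

/-! ### Convergence in probability to constants, and the weak law of large numbers. -/

section ConvergenceInMeasure

variable {Ω ι E F : Type*} [MeasurableSpace Ω] {μ : Measure Ω} {l : Filter ι}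

/-- The continuous mapping theorem for convergence in measure to a constant. -/
theorem MeasureTheory.TendstoInMeasure.comp_continuousAt [PseudoEMetricSpace E]
    [PseudoEMetricSpace F] {f : ι → Ω → E} {c : E} (hf : TendstoInMeasure μ f l fun _ => c)
    {h : E → F} (hh : ContinuousAt h c) :
    TendstoInMeasure μ (fun n ω => h (f n ω)) l fun _ => h c := by
  intro ε hε
  obtain ⟨δ, hδ, H⟩ := EMetric.continuousAt_iff.1 hh ε hε
  refine tendsto_of_tendsto_of_tendsto_of_le_of_le tendsto_const_nhds (hf δ hδ)
    (fun _ => zero_le) fun n => measure_mono fun ω hω => ?_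
  by_contra hlt
  exact absurd (H (not_le.1 hlt)) (not_lt.2 hω)

theorem MeasureTheory.TendstoInMeasure.prodMk_const [PseudoEMetricSpace E] [PseudoEMetricSpace F]
    {f : ι → Ω → E} {g : ι → Ω → F} {c : E} {d : F} (hf : TendstoInMeasure μ f l fun _ => c)
    (hg : TendstoInMeasure μ g l fun _ => d) :
    TendstoInMeasure μ (fun n ω => (f n ω, g n ω)) l fun _ => (c, d) := by
  intro ε hε
  have h0 := (hf ε hε).add (hg ε hε)
  rw [add_zero] at h0
  refine tendsto_of_tendsto_of_tendsto_of_le_of_le tendsto_const_nhds h0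
    (fun _ => zero_le) fun n => ?_
  refine (measure_mono fun ω hω => ?_).trans (measure_union_le _ _)
  simpa [Prod.edist_eq] using hω

theorem tendstoInMeasure_const [PseudoEMetricSpace E] (c : E) :
    TendstoInMeasure μ (fun (_ : ι) (_ : Ω) => c) l fun _ => c := by
  intro ε hε
  simpa [hε.not_ge] using tendsto_const_nhds

theorem MeasureTheory.TendstoInMeasure.add_const_limits {f g : ι → Ω → ℝ} {c d : ℝ}
    (hf : TendstoInMeasure μ f l fun _ => c) (hg : TendstoInMeasure μ g l fun _ => d) :
    TendstoInMeasure μ (fun n ω => f n ω + g n ω) l fun _ => c + d :=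
  (hf.prodMk_const hg).comp_continuousAt (h := fun p : ℝ × ℝ => p.1 + p.2)
    (by fun_prop)

/-- Averages over varying index sets obey the weak law of large numbers. -/
theorem weak_law_of_large_numbers [IsProbabilityMeasure μ] {β : Type*} [MeasurableSpace β]
    {X : ℕ → Ω → β} (hX : ∀ m, Measurable (X m)) (hind : iIndepFun X μ)
    (hid : ∀ m, IdentDistrib (X m) (X 0) μ μ) {f : β → ℝ} (hf : Measurable f)
    (hint : Integrable (fun ω => f (X 0 ω)) μ) {I : ℕ → Finset ℕ} (hI : ∀ N, (I N).card = N) :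
    TendstoInMeasure μ (fun (N : ℕ) ω => (1 / (N : ℝ)) * ∑ m ∈ I N, f (X m ω)) atTop
      fun _ => ∫ ω, f (X 0 ω) ∂μ := by
  have h1 : TendstoInMeasure μ (fun (N : ℕ) ω => (1 / (N : ℝ)) * ∑ m ∈ Finset.range N, f (X m ω)) atTop
      fun _ => ∫ ω, f (X 0 ω) ∂μ := by
    refine tendstoInMeasure_of_tendsto_ae (fun N => ?_) ?_
    · exact (Measurable.const_mul (Finset.measurable_sum _ fun m _ => hf.comp (hX m)) _).aestronglyMeasurable
    · have := strong_law_ae_real (fun m ω => f (X m ω)) hint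
        (fun a b hab => (hind.indepFun hab).comp hf hf) (fun m => (hid m).comp hf)
      filter_upwards [this] with ω hω
      refine hω.congr fun n => ?_
      rw [div_eq_inv_mul, one_div]
  -- The sets `I N` need not be nested, so the strong law does not apply to them. But the joint law
  -- of `N` distinct individuals does not depend on which ones are taken, and convergence in
  -- probability to a constant only sees the law of each average.
  have key : ∀ N, ∀ e : Fin N → ℕ, Function.Injective e →
      μ.map (fun ω j => X (e j) ω) = Measure.pi fun _ : Fin N => μ.map (X 0) := by
    intro N e he
    rw [(iIndepFun_iff_map_fun_eq_pi_map fun j => (hX (e j)).aemeasurable).1 (hind.precomp he)]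
    congr 1
    ext1 j
    exact (hid (e j)).map_eq
  intro ε hε
  refine (h1 ε hε).congr fun N => ?_
  have hS : MeasurableSet {y : Fin N → β |
      ε ≤ edist ((1 / (N : ℝ)) * ∑ j, f (y j)) (∫ ω, f (X 0 ω) ∂μ)} := by
    refine measurableSet_le measurable_const (Measurable.edist ?_ measurable_const)
    exact (Finset.measurable_sum _ fun j _ => hf.comp (measurable_pi_apply j)).const_mul _
  have hm : ∀ e : Fin N → ℕ, Function.Injective e →
      μ {ω | ε ≤ edist ((1 / (N : ℝ)) * ∑ j, f (X (e j) ω)) (∫ ω, f (X 0 ω) ∂μ)}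
        = (Measure.pi fun _ : Fin N => μ.map (X 0)) {y : Fin N → β |
            ε ≤ edist ((1 / (N : ℝ)) * ∑ j, f (y j)) (∫ ω, f (X 0 ω) ∂μ)} := by
    intro e he
    rw [← key N e he, Measure.map_apply (measurable_pi_lambda _ fun j => hX (e j)) hS]
    rfl
  have e1 := hm (fun j => (j : ℕ)) Fin.val_injective
  have e2 := hm (fun j => (I N).orderEmbOfFin (hI N) j) ((I N).orderEmbOfFin (hI N)).injective
  rw [← e2] at e1
  have s1 : ∀ ω, ∑ m ∈ Finset.range N, f (X m ω) = ∑ j : Fin N, f (X j ω) :=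
    fun ω => Finset.sum_range fun m => f (X m ω)
  have s2 : ∀ ω, ∑ m ∈ I N, f (X m ω) = ∑ j, f (X ((I N).orderEmbOfFin (hI N) j) ω) := by
    intro ω
    conv_lhs => rw [← Finset.map_orderEmbOfFin_univ (I N) (hI N)]
    rw [Finset.sum_map]
    rfl
  simp only [s1, s2]
  exact e1

end ConvergenceInMeasure

/-- The Cauchy-Schwarz inequality. -/
theorem lintegral_mul_sq_le {Ω : Type*} [MeasurableSpace Ω] {μ : Measure Ω} {f g : Ω → ℝ≥0∞}
    (hf : AEMeasurable f μ) (hg : AEMeasurable g μ) :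
    (∫⁻ ω, f ω * g ω ∂μ) ^ 2 ≤ (∫⁻ ω, f ω ^ 2 ∂μ) * ∫⁻ ω, g ω ^ 2 ∂μ := by
  have h := ENNReal.lintegral_mul_le_Lp_mul_Lq μ (p := 2) (q := 2)
    (by constructor <;> norm_num) hf hg
  calc (∫⁻ ω, f ω * g ω ∂μ) ^ 2
      ≤ ((∫⁻ a, f a ^ (2 : ℝ) ∂μ) ^ (1 / 2 : ℝ) * (∫⁻ a, g a ^ (2 : ℝ) ∂μ) ^ (1 / 2 : ℝ)) ^ 2 := by
        gcongr
        exact h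
    _ = _ := by
        rw [mul_pow, ← ENNReal.rpow_natCast, ← ENNReal.rpow_natCast, ← ENNReal.rpow_mul,
          ← ENNReal.rpow_mul]
        norm_num

namespace CausalModel

/-! ### Averages of functions trained on independent data. -/

section Averages

variable {Ω 𝒵 : Type*} [MeasurableSpace Ω] [MeasurableSpace 𝒵] {n : ℕ}
  {M : CausalModel Ω 𝒵 n} {μ : Measure Ω} {i : Fin n}

/-- The values of the random variables of one individual. -/
abbrev Individual (𝒵 : Type*) (n : ℕ) := 𝒵 × Fin n × (Fin n → ℝ) × (Fin n → ℝ)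

theorem Valid.measurable_individual (hM : M.Valid μ i) (m : ℕ) : Measurable (M.individual m) :=
  (hM.measurable_Z m).prodMk <| (hM.measurable_D m).prodMk <|
    (measurable_pi_lambda _ fun j => hM.measurable_ξF j m).prodMk
      (measurable_pi_lambda _ fun j => hM.measurable_ξCF j m)

/-- The observation as a function of the individual. -/
noncomputable def observe (M : CausalModel Ω 𝒵 n) (y : Individual 𝒵 n) : ℝ × Fin n × 𝒵 :=
  (M.g y.2.1 y.1 + y.2.2.1 y.2.1, y.2.1, y.1)

omit [MeasurableSpace Ω] [MeasurableSpace 𝒵] in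
theorem obs_eq_observe (m : ℕ) : M.obs m = M.observe ∘ M.individual m := by
  funext ω
  simp [obs, observed, outcome, observe, individual]

theorem Valid.measurable_observe (hM : M.Valid μ i) : Measurable M.observe := by
  have h1 : Measurable fun p : Fin n × 𝒵 => M.g p.1 p.2 :=
    measurable_from_prod_countable_right fun d => hM.measurable_g d
  have h2 : Measurable fun p : Fin n × (Fin n → ℝ) => p.2 p.1 :=
    measurable_from_prod_countable_right fun d => measurable_pi_apply d
  refine Measurable.prodMk (Measurable.add ?_ ?_) (by fun_prop)
  · exact h1.comp (g := fun p : Fin n × 𝒵 => M.g p.1 p.2)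
      (f := fun y : Individual 𝒵 n => (y.2.1, y.1)) (by fun_prop)
  · exact h2.comp (f := fun y : Individual 𝒵 n => (y.2.1, y.2.2.1)) (by fun_prop)

theorem Valid.measurable_obs (hM : M.Valid μ i) (m : ℕ) : Measurable (M.obs m) := by
  rw [obs_eq_observe]
  exact hM.measurable_observe.comp (hM.measurable_individual m)

/-- An individual outside the training sample is independent of the training data. -/
theorem Valid.lintegral_training (hM : M.Valid μ i) [IsProbabilityMeasure μ] {S : Finset ℕ} {m : ℕ}
    (hm : m ∉ S) {G : (S → ℝ × Fin n × 𝒵) × Individual 𝒵 n → ℝ≥0∞} (hG : Measurable G) :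
    ∫⁻ ω, G (fun s => M.obs s ω, M.individual m ω) ∂μ
      = ∫⁻ ω, ∫⁻ ω', G (fun s => M.obs s ω, M.individual 0 ω') ∂μ ∂μ := by
  have ht : Measurable fun ω (s : S) => M.obs s ω :=
    measurable_pi_lambda _ fun s => hM.measurable_obs s
  have hi : IndepFun (fun ω (s : S) => M.obs s ω) (M.individual m) μ := by
    have h := hM.indep.indepFun_finset S {m} (by simpa using hm) hM.measurable_individual
    have h' : Measurable fun y : ({m} : Finset ℕ) → Individual 𝒵 n =>
        y ⟨m, Finset.mem_singleton_self m⟩ := measurable_pi_apply _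
    have h'' : (fun ω (s : S) => M.obs s ω) = fun ω (s : S) => M.observe (M.individual s ω) := by
      simp only [obs_eq_observe, Function.comp_apply]
    rw [h'']
    exact h.comp (φ := fun y (s : S) => M.observe (y s))
      (measurable_pi_lambda _ fun s => hM.measurable_observe.comp (measurable_pi_apply s))
      h'
  have hX := hM.measurable_individual
  calc ∫⁻ ω, G (fun s => M.obs s ω, M.individual m ω) ∂μ
      = ∫⁻ p, G p ∂(μ.map fun ω => (fun s : S => M.obs s ω, M.individual m ω)) :=
        (lintegral_map hG (ht.prodMk (hX m))).symm
    _ = ∫⁻ p, G p ∂((μ.map fun ω (s : S) => M.obs s ω).prod (μ.map (M.individual 0))) := by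
        rw [hi.map_prod_eq_prod_map_map ht.aemeasurable (hX m).aemeasurable, (hM.ident m).map_eq]
    _ = ∫⁻ ω, ∫⁻ ω', G (fun s => M.obs s ω, M.individual 0 ω') ∂μ ∂μ := by
        rw [lintegral_prod _ hG.aemeasurable, lintegral_map hG.lintegral_prod_right' ht]
        refine lintegral_congr fun ω => ?_
        exact lintegral_map (hG.comp measurable_prodMk_left) (hX 0)

theorem measurable_training_integrand {S : Finset ℕ} {T₁ T₂ : (S → ℝ × Fin n × 𝒵) → 𝒵 → ℝ}
    (h₁ : Measurable (Function.uncurry T₁)) (h₂ : Measurable (Function.uncurry T₂))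
    {Φ : ℝ × ℝ × Individual 𝒵 n → ℝ≥0∞} (hΦ : Measurable Φ) :
    Measurable fun p : (S → ℝ × Fin n × 𝒵) × Individual 𝒵 n =>
      Φ (T₁ p.1 p.2.1, T₂ p.1 p.2.1, p.2) := by
  refine hΦ.comp (Measurable.prodMk ?_ (Measurable.prodMk ?_ measurable_snd))
  · exact h₁.comp (f := fun p : (S → ℝ × Fin n × 𝒵) × Individual 𝒵 n => (p.1, p.2.1))
      (by fun_prop)
  · exact h₂.comp (f := fun p : (S → ℝ × Fin n × 𝒵) × Individual 𝒵 n => (p.1, p.2.1))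
      (by fun_prop)

/-- Markov's inequality, conditionally on the training data. -/
theorem Valid.measure_average_ge_le (hM : M.Valid μ i) [IsProbabilityMeasure μ] {I S : Finset ℕ}
    (hIS : Disjoint I S) {T₁ T₂ : (S → ℝ × Fin n × 𝒵) → 𝒵 → ℝ}
    (h₁ : Measurable (Function.uncurry T₁)) (h₂ : Measurable (Function.uncurry T₂))
    {Φ : ℝ × ℝ × Individual 𝒵 n → ℝ≥0∞} (hΦ : Measurable Φ) {ε η : ℝ≥0∞} (hε : ε ≠ 0)
    (hε' : ε ≠ ∞) :
    μ {ω | ε ≤ (I.card : ℝ≥0∞)⁻¹ * ∑ m ∈ I,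
        Φ (M.trained T₁ ω (M.Z m ω), M.trained T₂ ω (M.Z m ω), M.individual m ω)}
      ≤ μ {ω | η < ∫⁻ ω', Φ (M.trained T₁ ω (M.Z 0 ω'), M.trained T₂ ω (M.Z 0 ω'),
          M.individual 0 ω') ∂μ} + η / ε := by
  set G : (S → ℝ × Fin n × 𝒵) × Individual 𝒵 n → ℝ≥0∞ :=
    fun p => Φ (T₁ p.1 p.2.1, T₂ p.1 p.2.1, p.2) with hGdef
  have hG : Measurable G := measurable_training_integrand h₁ h₂ hΦ
  have hX := hM.measurable_individual
  set ψ : (S → ℝ × Fin n × 𝒵) → ℝ≥0∞ := fun t => ∫⁻ ω', G (t, M.individual 0 ω') ∂μ with hψdef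
  have hψ : Measurable ψ := by
    have : ψ = fun t => ∫⁻ y, G (t, y) ∂(μ.map (M.individual 0)) := by
      funext t
      exact (lintegral_map (hG.comp measurable_prodMk_left) (hX 0)).symm
    rw [this]
    exact hG.lintegral_prod_right'
  have hA : MeasurableSet {t | ψ t ≤ η} := measurableSet_le hψ measurable_const
  -- The conditional mean `ψ` is small only for most training data. Discarding the data with `η < ψ`
  -- bounds the unconditional mean by `η`, so that Markov's inequality applies; the discarded event
  -- is the other term of the bound.
  set G' : (S → ℝ × Fin n × 𝒵) × Individual 𝒵 n → ℝ≥0∞ :=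
    fun p => {t | ψ t ≤ η}.indicator 1 p.1 * G p with hG'def
  have hG' : Measurable G' := ((measurable_one.indicator hA).comp measurable_fst).mul hG
  have ht : Measurable fun ω (s : S) => M.obs s ω :=
    measurable_pi_lambda _ fun s => hM.measurable_obs s
  have hb : ∀ m ∈ I, ∫⁻ ω, G' (fun s => M.obs s ω, M.individual m ω) ∂μ ≤ η := by
    intro m hm
    rw [hM.lintegral_training (Finset.disjoint_left.1 hIS hm) hG']
    calc _ ≤ ∫⁻ _, η ∂μ := by
          refine lintegral_mono fun ω => ?_
          simp only [hG'def]
          have hGω : Measurable fun ω' => G (fun s => M.obs s ω, M.individual 0 ω') :=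
            hG.comp (measurable_prodMk_left.comp (hX 0))
          rw [lintegral_const_mul _ hGω]
          by_cases h : ψ (fun s => M.obs s ω) ≤ η
          · rw [Set.indicator_of_mem (show _ ∈ {t | ψ t ≤ η} from h), Pi.one_apply, one_mul]
            exact h
          · simp [h]
      _ = η := by simp
  have hmeas : ∀ m, Measurable fun ω => G' (fun s => M.obs s ω, M.individual m ω) :=
    fun m => hG'.comp (ht.prodMk (hX m))
  have hint : ∫⁻ ω, (I.card : ℝ≥0∞)⁻¹ * ∑ m ∈ I, G' (fun s => M.obs s ω, M.individual m ω) ∂μ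
      ≤ η := by
    rw [lintegral_const_mul _ (Finset.measurable_sum _ fun m _ => hmeas m),
      lintegral_finsetSum _ fun m _ => hmeas m]
    calc _ ≤ (I.card : ℝ≥0∞)⁻¹ * ∑ m ∈ I, η := by gcongr with m hm; exact hb m hm
      _ = (I.card : ℝ≥0∞)⁻¹ * (I.card : ℝ≥0∞) * η := by simp [mul_assoc]
      -- Only an inequality, since `I` may be empty.
      _ ≤ 1 * η := by gcongr; exact ENNReal.inv_mul_le_one _
      _ = η := one_mul η
  refine (measure_mono (t := {ω | η < ψ fun s => M.obs s ω} ∪ {ω | ε ≤ (I.card : ℝ≥0∞)⁻¹ *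
    ∑ m ∈ I, G' (fun s => M.obs s ω, M.individual m ω)}) fun ω hω => ?_).trans
    ((measure_union_le _ _).trans (add_le_add le_rfl ?_))
  · by_cases h : ψ (fun s => M.obs s ω) ≤ η
    · right
      simp only [hG'def, Set.mem_ofPred_eq, h, Set.indicator_of_mem, Pi.one_apply, one_mul]
      exact hω
    · exact Or.inl (not_le.1 h)
  · refine (meas_ge_le_lintegral_div ?_ hε hε').trans (by gcongr)
    exact (Measurable.const_mul (Finset.measurable_sum _ fun m _ => hmeas m) _).aemeasurable

/-- The weak law of large numbers for averages that involve the trained functions, provided that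
the expectation is stable at the true nuisance parameters. -/
theorem Valid.tendstoInMeasure_average (hM : M.Valid μ i) [IsProbabilityMeasure μ]
    {I Ic : ℕ → Finset ℕ} (hcard : ∀ N, (I N).card = N) (hdisj : ∀ N, Disjoint (I N) (Ic N))
    {gTrain πTrain : (N : ℕ) → (Ic N → ℝ × Fin n × 𝒵) → 𝒵 → ℝ}
    (hg : ∀ N, Measurable (Function.uncurry (gTrain N)))
    (hπ : ∀ N, Measurable (Function.uncurry (πTrain N)))
    {Φ : ℝ × ℝ × Individual 𝒵 n → ℝ} (hΦ : Measurable Φ)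
    (hint : Integrable (fun ω => Φ (M.g i (M.Z 0 ω), M.prop i (M.Z 0 ω), M.individual 0 ω)) μ)
    (hstab : ∀ ε : ℝ≥0∞, 0 < ε → Tendsto (fun N => μ {ω | ε < ∫⁻ ω',
      ‖Φ (M.trained (gTrain N) ω (M.Z 0 ω'), M.trained (πTrain N) ω (M.Z 0 ω'), M.individual 0 ω')
        - Φ (M.g i (M.Z 0 ω'), M.prop i (M.Z 0 ω'), M.individual 0 ω')‖ₑ ∂μ}) atTop (𝓝 0)) :
    TendstoInMeasure μ (fun (N : ℕ) ω => (1 / (N : ℝ)) * ∑ m ∈ I N,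
        Φ (M.trained (gTrain N) ω (M.Z m ω), M.trained (πTrain N) ω (M.Z m ω), M.individual m ω))
      atTop fun _ => ∫ ω, Φ (M.g i (M.Z 0 ω), M.prop i (M.Z 0 ω), M.individual 0 ω) ∂μ := by
  have hΨ : Measurable fun y : Individual 𝒵 n => Φ (M.g i y.1, M.prop i y.1, y) :=
    hΦ.comp (((hM.measurable_g i).comp measurable_fst).prodMk
      (((hM.measurable_prop i).comp measurable_fst).prodMk measurable_id))
  have h1 := weak_law_of_large_numbers hM.measurable_individual hM.indep hM.ident hΨ hint hcard
  set Δ : ℝ × ℝ × Individual 𝒵 n → ℝ :=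
    fun p => Φ p - Φ (M.g i p.2.2.1, M.prop i p.2.2.1, p.2.2) with hΔdef
  have hΔ : Measurable Δ := hΦ.sub (hΨ.comp (measurable_snd.comp measurable_snd))
  have h2 : TendstoInMeasure μ (fun (N : ℕ) ω => (1 / (N : ℝ)) * ∑ m ∈ I N,
      Δ (M.trained (gTrain N) ω (M.Z m ω), M.trained (πTrain N) ω (M.Z m ω), M.individual m ω))
      atTop fun _ => 0 := by
    rw [tendstoInMeasure_iff_enorm]
    intro ε hε hε'
    rw [ENNReal.tendsto_nhds_zero]
    intro δ hδ
    set δ' := min δ 1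
    have hδ' : 0 < δ' := lt_min hδ one_pos
    have hδt : δ' ≠ ∞ := ne_top_of_le_ne_top ENNReal.one_ne_top (min_le_right _ _)
    -- Half of `δ'` is spent on the exceptional training data, the other half on `η / ε`.
    set η := δ' / 2 * ε with hη
    have hη0 : 0 < η := ENNReal.mul_pos (ENNReal.half_pos hδ'.ne').ne' hε.ne'
    filter_upwards [(ENNReal.tendsto_nhds_zero.1 (hstab η hη0)) (δ' / 2)
      (ENNReal.half_pos hδ'.ne')] with N hN
    have h3 := hM.measure_average_ge_le (hdisj N) (hg N) (hπ N) (Φ := fun p => ‖Δ p‖ₑ)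
      hΔ.enorm (η := η) hε.ne' hε'
    refine (measure_mono fun ω hω => ?_).trans (h3.trans ?_)
    · refine le_trans (Set.mem_ofPred_eq ▸ hω) ?_
      rw [sub_zero, enorm_mul, hcard N]
      refine mul_le_mul' ?_ (enorm_sum_le _ _)
      -- At `N = 0` the inverse is `0` in `ℝ` but `∞` in `ℝ≥0∞`.
      rcases eq_or_ne N 0 with rfl | hN0
      · simp
      · rw [one_div, enorm_inv (by exact_mod_cast hN0)]
        simp
    · calc _ ≤ δ' / 2 + δ' / 2 := by
            refine add_le_add hN ?_
            rw [hη, ENNReal.mul_div_cancel_right hε.ne' hε']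
        _ = δ' := ENNReal.add_halves _
        _ ≤ δ := min_le_left _ _
  have h3 := h1.add_const_limits h2
  simp only [add_zero] at h3
  convert h3 using 3 with N ω
  · rw [← mul_add, ← Finset.sum_add_distrib]
    simp [hΔdef, individual]
  · rfl

end Averages


/-! ### The propensity score, and the mean of the weighted noise. -/

section Model

variable {Ω 𝒵 : Type*} [MeasurableSpace Ω] [MeasurableSpace 𝒵] {n : ℕ}
  {M : CausalModel Ω 𝒵 n} {μ : Measure Ω} {i : Fin n}

theorem Valid.measurable_treated (hM : M.Valid μ i) (m : ℕ) : Measurable (M.treated i m) :=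
  Measurable.ite (hM.measurable_D m (measurableSet_singleton i)) measurable_const measurable_const

theorem Valid.measurable_ν (hM : M.Valid μ i) (m : ℕ) : Measurable (M.ν i m) :=
  (hM.measurable_treated m).sub ((hM.measurable_prop i).comp (hM.measurable_Z m))

omit [MeasurableSpace Ω] [MeasurableSpace 𝒵] in
theorem treated_nonneg (m : ℕ) (ω : Ω) : 0 ≤ M.treated i m ω := by
  unfold treated; split_ifs <;> simp

omit [MeasurableSpace Ω] [MeasurableSpace 𝒵] in
theorem treated_le_one (m : ℕ) (ω : Ω) : M.treated i m ω ≤ 1 := by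
  unfold treated; split_ifs <;> simp

variable [IsProbabilityMeasure μ]

theorem Valid.integrable_treated (hM : M.Valid μ i) (m : ℕ) : Integrable (M.treated i m) μ :=
  Integrable.of_bound (hM.measurable_treated m).aestronglyMeasurable 1 <| .of_forall fun ω => by
    rw [Real.norm_of_nonneg (treated_nonneg m ω)]; exact treated_le_one m ω

theorem Valid.condExp_treated (hM : M.Valid μ i) (m : ℕ) :
    μ[M.treated i m | MeasurableSpace.comap (M.Z m) inferInstance]
      =ᵐ[μ] fun ω => M.prop i (M.Z m ω) := by
  have hle : MeasurableSpace.comap (M.Z m) inferInstance ≤ ‹MeasurableSpace Ω› :=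
    (hM.measurable_Z m).comap_le
  have hint : Integrable (fun ω => M.prop i (M.Z m ω)) μ := by
    convert (hM.integrable_treated m).sub (hM.integrable_ν m) using 2 with ω
    simp [ν]
  have hsm : StronglyMeasurable[MeasurableSpace.comap (M.Z m) inferInstance]
      fun ω => M.prop i (M.Z m ω) :=
    ((hM.measurable_prop i).comp (comap_measurable (M.Z m))).stronglyMeasurable
  have heq : M.treated i m = M.ν i m + fun ω => M.prop i (M.Z m ω) := by
    funext ω; simp [ν]
  rw [heq]
  refine (condExp_add (hM.integrable_ν m) hint _).trans ?_
  filter_upwards [hM.condExp_ν m] with ω hω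
  simp [hω, condExp_of_stronglyMeasurable hle hsm hint]

/-- The function `prop` is bounded only through being the conditional expectation of an indicator.
This is what makes `ν` bounded and its moments finite. -/
theorem Valid.prop_mem_Icc (hM : M.Valid μ i) (m : ℕ) :
    ∀ᵐ ω ∂μ, M.prop i (M.Z m ω) ∈ Set.Icc (0 : ℝ) 1 := by
  have hle : MeasurableSpace.comap (M.Z m) inferInstance ≤ ‹MeasurableSpace Ω› :=
    (hM.measurable_Z m).comap_le
  have h0 : 0 ≤ᵐ[μ] μ[M.treated i m | MeasurableSpace.comap (M.Z m) inferInstance] :=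
    condExp_nonneg (.of_forall (treated_nonneg m))
  have h1 : μ[M.treated i m | MeasurableSpace.comap (M.Z m) inferInstance]
      ≤ᵐ[μ] μ[fun _ => (1 : ℝ) | MeasurableSpace.comap (M.Z m) inferInstance] :=
    condExp_mono (hM.integrable_treated m) (integrable_const 1) (.of_forall (treated_le_one m))
  rw [condExp_const hle] at h1
  filter_upwards [h0, h1, hM.condExp_treated m] with ω a b c
  rw [c] at a b
  exact ⟨a, b⟩

theorem Valid.abs_ν_le_one (hM : M.Valid μ i) (m : ℕ) : ∀ᵐ ω ∂μ, |M.ν i m ω| ≤ 1 := by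
  filter_upwards [hM.prop_mem_Icc m] with ω hω
  have h0 := treated_nonneg (M := M) (i := i) m ω
  have h1 := treated_le_one (M := M) (i := i) m ω
  rw [ν, abs_le]
  constructor <;> linarith [hω.1, hω.2]

/-- On the `Z`-measurable event `π(Z) = 1` the nonnegative variable `1 - 1_D` has integral zero. The
event needs care because its treated individuals have `ν = 0`, which the sign of `ν` does not
detect. -/
theorem Valid.treated_eq_one_of_prop_eq_one (hM : M.Valid μ i) (m : ℕ) :
    ∀ᵐ ω ∂μ, M.prop i (M.Z m ω) = 1 → M.treated i m ω = 1 := by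
  have hle : MeasurableSpace.comap (M.Z m) inferInstance ≤ ‹MeasurableSpace Ω› :=
    (hM.measurable_Z m).comap_le
  have hsB : MeasurableSet (M.prop i ⁻¹' {1}) := hM.measurable_prop i (measurableSet_singleton 1)
  set B : Set Ω := M.Z m ⁻¹' (M.prop i ⁻¹' {1})
  have hB : MeasurableSet[MeasurableSpace.comap (M.Z m) inferInstance] B := ⟨_, hsB, rfl⟩
  have hB' : MeasurableSet B := hle _ hB
  have h1 : ∫ ω in B, (1 - M.treated i m ω) ∂μ = 0 := by
    have h2 : ∫ ω in B, M.treated i m ω ∂μ = ∫ ω in B, 1 ∂μ := by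
      rw [← setIntegral_condExp hle (hM.integrable_treated m) hB]
      refine setIntegral_congr_ae hB' ?_
      filter_upwards [hM.condExp_treated m] with ω hω hωB
      rw [hω]; exact hωB
    rw [integral_sub (integrable_const 1).integrableOn (hM.integrable_treated m).integrableOn, h2,
      sub_self]
  rw [integral_eq_zero_iff_of_nonneg (fun ω => sub_nonneg.2 (treated_le_one m ω))
    ((integrable_const 1).sub (hM.integrable_treated m)).integrableOn] at h1
  filter_upwards [(ae_restrict_iff' hB').1 h1] with ω hω hp
  have := hω hp
  simp only [Pi.zero_apply] at this
  linarith

/-- The treatment indicator is almost surely a function of `ν`, up to a function of the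
covariates. -/
theorem Valid.treated_eq (hM : M.Valid μ i) (m : ℕ) : ∀ᵐ ω ∂μ, M.treated i m ω =
    Set.indicator (Set.Ioi 0) 1 (M.ν i m ω) + Set.indicator {1} 1 (M.prop i (M.Z m ω)) := by
  filter_upwards [hM.prop_mem_Icc m, hM.treated_eq_one_of_prop_eq_one m] with ω h1 h2
  -- If `π(Z) < 1`, then `ν` is `1 - π(Z) > 0` for the treated and `-π(Z) ≤ 0` for the others, so
  -- its sign decides; if `π(Z) = 1`, then `ν = 0` and the second indicator does.
  by_cases hp : M.prop i (M.Z m ω) = 1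
  · have := h2 hp
    simp [ν, hp, this]
  · have hlt := lt_of_le_of_ne h1.2 hp
    by_cases hD : M.D m ω = i
    · simp [ν, treated, hp, hD, hlt]
    · simp [ν, treated, hp, hD, h1.1.not_gt]

theorem Valid.integrable_ξF (hM : M.Valid μ i) (m : ℕ) : Integrable (M.ξF i m) μ :=
  (hM.memLp_ξF m).integrable (by norm_num)

theorem Valid.integral_ξF (hM : M.Valid μ i) (m : ℕ) : ∫ ω, M.ξF i m ω ∂μ = 0 := by
  rw [← integral_condExp (hM.measurable_Z m).comap_le, integral_congr_ae (hM.condExp_ξF m)]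
  simp

/-- The factual noise has mean zero under every weight that is a power of `ν`, although it is only
assumed to be independent of `ν` and of `Z` separately. -/
theorem Valid.integral_treated_mul_noise (hM : M.Valid μ i) (m q : ℕ) :
    ∫ ω, M.treated i m ω * M.ξF i m ω * M.ν i m ω ^ q ∂μ = 0 := by
  -- The weight is `f(ν) + h(Z)`. The factor `0 ^ q` in `h` is the value of `ν ^ q` where `π(Z) =
  -- 1`; it equals `1` for `q = 0`.
  set f : ℝ → ℝ := fun t => Set.indicator (Set.Ioi 0) 1 t * t ^ q
  set h : 𝒵 → ℝ := fun z => Set.indicator {1} 1 (M.prop i z) * 0 ^ q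
  have hf : Measurable f :=
    (measurable_one.indicator measurableSet_Ioi).mul (measurable_id.pow_const q)
  have hh : Measurable h :=
    ((measurable_one.indicator (measurableSet_singleton 1)).comp (hM.measurable_prop i)).mul_const _
  have e : ∀ᵐ ω ∂μ, M.treated i m ω * M.ξF i m ω * M.ν i m ω ^ q
      = M.ξF i m ω * f (M.ν i m ω) + M.ξF i m ω * h (M.Z m ω) := by
    filter_upwards [hM.treated_eq m, hM.treated_eq_one_of_prop_eq_one m] with ω h1 h2
    by_cases hp : M.prop i (M.Z m ω) = 1
    · have hν : M.ν i m ω = 0 := by simp [ν, hp, h2 hp]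
      simp [f, h, hp, hν, h2 hp]
    · rw [h1]
      simp [f, h, hp]
      ring
  have i1 := (hM.indep_ξF_ν m).comp measurable_id hf
  have i2 := (hM.indep_ξF_Z m).comp measurable_id hh
  have hξ := hM.integrable_ξF m
  have hfν : ∀ᵐ ω ∂μ, ‖f (M.ν i m ω)‖ ≤ 1 := by
    filter_upwards [hM.abs_ν_le_one m] with ω hω
    simp only [f, norm_mul, norm_pow, Real.norm_eq_abs]
    refine mul_le_one₀ ?_ (by positivity) (pow_le_one₀ (abs_nonneg _) hω)
    by_cases hc : 0 < M.ν i m ω <;> simp [hc]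
  have hhZ : ∀ᵐ ω ∂μ, ‖h (M.Z m ω)‖ ≤ 1 := by
    refine .of_forall fun ω => ?_
    simp only [h, norm_mul, norm_pow, Real.norm_eq_abs, abs_zero]
    refine mul_le_one₀ ?_ (by positivity) (pow_le_one₀ le_rfl zero_le_one)
    by_cases hc : M.prop i (M.Z m ω) = 1 <;> simp [hc]
  have mfν : AEStronglyMeasurable (fun ω => f (M.ν i m ω)) μ :=
    (hf.comp (hM.measurable_ν m)).aestronglyMeasurable
  have mhZ : AEStronglyMeasurable (fun ω => h (M.Z m ω)) μ :=
    (hh.comp (hM.measurable_Z m)).aestronglyMeasurable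
  rw [integral_congr_ae e, integral_add (hξ.mul_bdd mfν hfν) (hξ.mul_bdd mhZ hhZ)]
  have z1 := i1.integral_mul_eq_mul_integral hξ.aestronglyMeasurable mfν
  have z2 := i2.integral_mul_eq_mul_integral hξ.aestronglyMeasurable mhZ
  have z0 : ∫ ω, (id ∘ M.ξF i m) ω ∂μ = 0 := hM.integral_ξF m
  rw [z0, zero_mul] at z1 z2
  exact (congrArg₂ (· + ·) z1 z2).trans (add_zero 0)

/-- A treatment of probability zero would have `π(Z) = E[1_D | Z] = 0`, hence `ν = 0` and vanishing
moments. Positivity permits division by the proportion of treated individuals. -/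
theorem Valid.integral_treated_pos (hM : M.Valid μ i) {r : ℕ} (hr : r ≠ 0)
    (hmom : M.moment μ i r ≠ 0) : 0 < ∫ ω, M.treated i 0 ω ∂μ := by
  refine lt_of_le_of_ne (integral_nonneg (treated_nonneg 0)) fun h => hmom ?_
  have h1 := (integral_eq_zero_iff_of_nonneg (treated_nonneg 0) (hM.integrable_treated 0)).1 h.symm
  have h2 : ∀ᵐ ω ∂μ, M.ν i 0 ω = 0 := by
    have h3 := (condExp_congr_ae (m := MeasurableSpace.comap (M.Z 0) inferInstance) h1).symm.trans
      (hM.condExp_treated 0)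
    filter_upwards [h1, h3] with ω a b
    rw [condExp_zero] at b
    simp only [Pi.zero_apply] at a b
    rw [ν, a, ← b, sub_zero]
  rw [moment, integral_congr_ae (g := fun _ => (0 : ℝ)) (by
    filter_upwards [h2] with ω hω; simp [hω, hr])]
  simp

end Model


/-! ### Smallness of the integrated errors near the true nuisance parameters. -/

section Stability

variable {Ω 𝒵 : Type*} [MeasurableSpace Ω] [MeasurableSpace 𝒵] {n : ℕ}
  {M : CausalModel Ω 𝒵 n} {μ : Measure Ω} {i : Fin n}

/-- The first-stage errors up to order `k` of the fixed functions `x` and `a` are at most `η`. -/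
def IsNear (M : CausalModel Ω 𝒵 n) (μ : Measure Ω) (i : Fin n) (k : ℕ) (η : ℝ≥0∞)
    (x a : 𝒵 → ℝ) : Prop :=
  ∀ α : ℕ × ℕ, 1 ≤ α.1 + α.2 → α.1 + α.2 ≤ k →
    M.nuisanceError μ i (4 * α.1, 4 * α.2) x a ≤ η

theorem IsNear.mono {k : ℕ} {η η' : ℝ≥0∞} {x a : 𝒵 → ℝ} (h : M.IsNear μ i k η x a)
    (hη : η ≤ η') : M.IsNear μ i k η' x a :=
  fun α h1 h2 => (h α h1 h2).trans hη

theorem Valid.nuisanceError_eq (hM : M.Valid μ i) {x a : 𝒵 → ℝ} (hx : Measurable x)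
    (ha : Measurable a) (p : ℕ × ℕ) : M.nuisanceError μ i p x a
      = ∫⁻ ω, ‖x (M.Z 0 ω) - M.g i (M.Z 0 ω)‖ₑ ^ p.1
          * ‖a (M.Z 0 ω) - M.prop i (M.Z 0 ω)‖ₑ ^ p.2 ∂μ := by
  have := hM.measurable_g i
  have := hM.measurable_prop i
  exact lintegral_map (by fun_prop) (hM.measurable_Z 0)

variable [IsProbabilityMeasure μ]

/-- Consistency controls fourth powers up to order `k`, whereas regularity asks for second powers up
to order `k + 1`. Writing `α = β + γ` with `β` of order one, the Cauchy-Schwarz inequality bounds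
the square by the errors of orders `4β` and `4γ`: the first is at most `η`, the second at most `1`,
even when `γ = 0`. -/
theorem IsNear.nuisanceError_sq_le (hM : M.Valid μ i) {k : ℕ} (hk : 1 ≤ k) {η : ℝ≥0∞}
    (hη : η ≤ 1) {x a : 𝒵 → ℝ} (hx : Measurable x) (ha : Measurable a)
    (h : M.IsNear μ i k η x a) {α : ℕ × ℕ} (h1 : 1 ≤ α.1 + α.2) (h2 : α.1 + α.2 ≤ k + 1) :
    M.nuisanceError μ i (2 * α.1, 2 * α.2) x a ^ 2 ≤ η := by
  have hg := hM.measurable_g i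
  have hp := hM.measurable_prop i
  have hpr : IsProbabilityMeasure (μ.map (M.Z 0)) :=
    Measure.isProbabilityMeasure_map (hM.measurable_Z 0).aemeasurable
  obtain ⟨β, γ, hβ, hβ1, hβk, hγ⟩ : ∃ β γ : ℕ × ℕ, α = β + γ ∧ 1 ≤ β.1 + β.2 ∧ β.1 + β.2 ≤ k ∧
      γ.1 + γ.2 ≤ k := by
    obtain ⟨a1, a2⟩ := α
    rcases Nat.eq_zero_or_pos a1 with h0 | h0
    · exact ⟨(0, 1), (a1, a2 - 1), by simp; simp at h1 h2; omega, by simp, by simpa using hk,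
        by simp at h1 h2 ⊢; omega⟩
    · exact ⟨(1, 0), (a1 - 1, a2), by simp; omega, by simp, by simpa using hk,
        by simp at h1 h2 ⊢; omega⟩
  have hγ1 : M.nuisanceError μ i (4 * γ.1, 4 * γ.2) x a ≤ 1 := by
    rcases Nat.eq_zero_or_pos (γ.1 + γ.2) with h0 | h0
    · have e1 : γ.1 = 0 := by omega
      have e2 : γ.2 = 0 := by omega
      simp [nuisanceError, e1, e2]
    · exact (h γ h0 hγ).trans hη
  have cs := lintegral_mul_sq_le (μ := μ.map (M.Z 0))
    (f := fun z => ‖x z - M.g i z‖ₑ ^ (2 * β.1) * ‖a z - M.prop i z‖ₑ ^ (2 * β.2))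
    (g := fun z => ‖x z - M.g i z‖ₑ ^ (2 * γ.1) * ‖a z - M.prop i z‖ₑ ^ (2 * γ.2))
    (by fun_prop) (by fun_prop)
  have e0 : M.nuisanceError μ i (2 * α.1, 2 * α.2) x a = ∫⁻ z,
      (‖x z - M.g i z‖ₑ ^ (2 * β.1) * ‖a z - M.prop i z‖ₑ ^ (2 * β.2)) *
      (‖x z - M.g i z‖ₑ ^ (2 * γ.1) * ‖a z - M.prop i z‖ₑ ^ (2 * γ.2)) ∂(μ.map (M.Z 0)) := by
    refine lintegral_congr fun z => ?_
    rw [hβ]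
    simp only [Prod.fst_add, Prod.snd_add]
    ring
  have e1 : ∀ β : ℕ × ℕ, ∫⁻ z, (‖x z - M.g i z‖ₑ ^ (2 * β.1) * ‖a z - M.prop i z‖ₑ ^ (2 * β.2)) ^ 2
      ∂(μ.map (M.Z 0)) = M.nuisanceError μ i (4 * β.1, 4 * β.2) x a := by
    intro β
    refine lintegral_congr fun z => ?_
    ring
  rw [e0]
  refine cs.trans ?_
  rw [e1, e1]
  calc _ ≤ η * 1 := mul_le_mul' (h β hβ1 hβk) hγ1
    _ = η := mul_one η

/-- Differentiation in `x` removes the outcome, so regularity at this order is a fourth moment bound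
on the weight alone. -/
theorem scoreDiff_one_zero (mom : ℕ → ℝ) (r k : ℕ) (ϑ y δ x a : ℝ) :
    scoreDiff mom r k (1, 0) ϑ y δ x a = weightA mom r k δ a - 1 := by
  simp only [scoreDiff, iteratedDeriv_zero, iteratedDeriv_one, scoreFn]
  have h : HasDerivAt (fun x' => ϑ - x' - (y - x') * weightA mom r k δ a)
      ((0 - 1) - (0 - 1) * weightA mom r k δ a) x :=
    (((hasDerivAt_const x ϑ).sub (hasDerivAt_id x))).sub
      (((hasDerivAt_const x y).sub (hasDerivAt_id x)).mul_const _)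
  rw [h.deriv]
  ring

theorem pow_le_one_add_pow {t : ℝ} (ht : 0 ≤ t) {q r : ℕ} (hq : q ≤ r) : t ^ q ≤ 1 + t ^ r := by
  rcases le_total t 1 with h | h
  · exact (pow_le_one₀ ht h).trans (by simp [pow_nonneg ht])
  · exact (pow_le_pow_right₀ h hq).trans (by simp)

/-- The leading power is controlled by the weight and by the lower powers. -/
theorem exists_pow_le_weightA {mom : ℕ → ℝ} {r k : ℕ} (hmom : mom r ≠ 0) :
    ∃ K : ℝ, 0 ≤ K ∧ ∀ δ a p : ℝ, |δ - p| ≤ 1 → |δ - a| ^ (4 * r) ≤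
      K * (|weightA mom r k δ a - 1| ^ 4 + 1 + |a - p| ^ (4 * k)) := by
  -- `K₀ - 1` bounds the lower-order sum relative to `1 + |δ - a| ^ k`. In `K₁`, the factor `|mom
  -- r|` comes from solving the weight for its leading power, and `2 * 2 ^ k` from `hVk`.
  set K₀ : ℝ := 1 + ∑ q ∈ Finset.Icc 1 (k - 1), |coeffB mom r k q| * (1 + |mom q|) with hK₀
  have hS0 : 0 ≤ ∑ q ∈ Finset.Icc 1 (k - 1), |coeffB mom r k q| * (1 + |mom q|) :=
    Finset.sum_nonneg fun q _ => by positivity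
  set K₁ := |mom r| * K₀ * (2 * 2 ^ k) with hK₁
  have hK₀p : 1 ≤ K₀ := by rw [hK₀]; linarith
  have hK₁p : 0 ≤ K₁ := by positivity
  -- Here `64 = 8 * 8`, from two uses of `(a + b) ^ 4 ≤ 8 * (a ^ 4 + b ^ 4)`.
  refine ⟨K₁ ^ 4 * 64, by positivity, fun δ a p hδ => ?_⟩
  set A := weightA mom r k δ a - 1 with hA
  have hv : |δ - a| ≤ 1 + |a - p| := by
    calc |δ - a| = |(δ - p) - (a - p)| := by ring_nf
      _ ≤ |δ - p| + |a - p| := abs_sub _ _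
      _ ≤ _ := by linarith
  have hVk : 1 + |δ - a| ^ k ≤ 2 * 2 ^ k * (1 + |a - p| ^ k) := by
    have h1 : |δ - a| ^ k ≤ 2 ^ k * (1 + |a - p| ^ k) := by
      refine (pow_le_pow_left₀ (abs_nonneg _) hv k).trans ?_
      rcases le_total |a - p| 1 with h | h
      · calc (1 + |a - p|) ^ k ≤ 2 ^ k := pow_le_pow_left₀ (by positivity) (by linarith) k
          _ ≤ _ := le_mul_of_one_le_right (by positivity) (by simp)
      · calc (1 + |a - p|) ^ k ≤ (2 * |a - p|) ^ k := pow_le_pow_left₀ (by positivity) (by linarith) k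
          _ = 2 ^ k * |a - p| ^ k := mul_pow _ _ _
          _ ≤ _ := by gcongr; simp
    have h2 : 1 ≤ 2 ^ k * (1 + |a - p| ^ k) := by
      have : (1 : ℝ) ≤ 2 ^ k := one_le_pow₀ (by norm_num)
      have h3 : 1 ≤ 1 + |a - p| ^ k := by simp
      nlinarith
    linarith
  have hlow : |∑ q ∈ Finset.Icc 1 (k - 1), coeffB mom r k q * ((δ - a) ^ q - mom q)|
      ≤ (∑ q ∈ Finset.Icc 1 (k - 1), |coeffB mom r k q| * (1 + |mom q|)) * (1 + |δ - a| ^ k) := by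
    rw [Finset.sum_mul]
    refine (Finset.abs_sum_le_sum_abs _ _).trans (Finset.sum_le_sum fun q hq => ?_)
    rw [abs_mul, mul_assoc]
    gcongr
    have hqk : q ≤ k := by have := Finset.mem_Icc.1 hq; omega
    have h1 := pow_le_one_add_pow (abs_nonneg (δ - a)) hqk
    calc |(δ - a) ^ q - mom q| ≤ |(δ - a) ^ q| + |mom q| := abs_sub _ _
      _ = |δ - a| ^ q + |mom q| := by rw [abs_pow]
      _ ≤ _ := by nlinarith [abs_nonneg (mom q), pow_nonneg (abs_nonneg (δ - a)) k]
  have hV : |δ - a| ^ r ≤ K₁ * (|A| + 1 + |a - p| ^ k) := by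
    have e : (δ - a) ^ r = mom r * ((A + 1)
        - ∑ q ∈ Finset.Icc 1 (k - 1), coeffB mom r k q * ((δ - a) ^ q - mom q)) := by
      rw [hA, weightA]
      field_simp
      ring
    have h3 : |δ - a| ^ r ≤ |mom r| * (|A| + 1 +
        (∑ q ∈ Finset.Icc 1 (k - 1), |coeffB mom r k q| * (1 + |mom q|)) * (1 + |δ - a| ^ k)) := by
      rw [← abs_pow, e, abs_mul]
      gcongr
      refine (abs_sub _ _).trans (add_le_add ?_ hlow)
      simpa using abs_add_le A 1
    refine h3.trans ?_
    rw [hK₁]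
    rw [mul_assoc, mul_assoc]
    gcongr
    have h5 : |A| + 1 + (K₀ - 1) * (1 + |δ - a| ^ k) ≤ K₀ * (|A| + (1 + |δ - a| ^ k)) := by
      nlinarith [abs_nonneg A, pow_nonneg (abs_nonneg (δ - a)) k]
    have h6 : ∑ q ∈ Finset.Icc 1 (k - 1), |coeffB mom r k q| * (1 + |mom q|) = K₀ - 1 := by
      rw [hK₀]; ring
    rw [h6]
    refine h5.trans ?_
    gcongr
    have h7 : (1 : ℝ) ≤ 2 * 2 ^ k := by
      have : (1 : ℝ) ≤ 2 ^ k := one_le_pow₀ (by norm_num)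
      linarith
    nlinarith [abs_nonneg A]
  have hp := pow_le_pow_left₀ (by positivity) hV 4
  rw [← pow_mul, mul_comm r 4, mul_pow] at hp
  refine hp.trans ?_
  rw [mul_assoc]
  gcongr
  have a1 := add_pow_le (a := |A| + 1) (b := |a - p| ^ k) (by positivity) (by positivity) 4
  have a2 := add_pow_le (a := |A|) (b := 1) (by positivity) (by positivity) 4
  have a3 : (|a - p| ^ k) ^ 4 = |a - p| ^ (4 * k) := by rw [← pow_mul, mul_comm]
  rw [a3] at a1
  have a4 : 0 ≤ |a - p| ^ (4 * k) := by positivity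
  norm_num at a1 a2
  nlinarith

/-- Near the true nuisance parameters, the moment of order `4 r` is bounded. -/
theorem Valid.exists_moment_bound (hM : M.Valid μ i) {r k : ℕ} (hk : 1 ≤ k)
    (hmom : M.moment μ i r ≠ 0) {𝒯 : Set ((𝒵 → ℝ) × (𝒵 → ℝ))}
    (hreg : M.MomentsRegular μ i r k 𝒯) :
    ∃ η : ℝ≥0∞, 0 < η ∧ ∃ C : ℝ≥0, ∀ x a : 𝒵 → ℝ, (x, a) ∈ 𝒯 → Measurable x → Measurable a →
      M.IsNear μ i k η x a →
      ∫⁻ ω, ENNReal.ofReal (|M.treated i 0 ω - a (M.Z 0 ω)| ^ (4 * r)) ∂μ ≤ C := by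
  obtain ⟨ρ, hρ, B, hB⟩ := hreg
  obtain ⟨K, hK0, hK⟩ := exists_pow_le_weightA (k := k) hmom
  -- The squares of the second-power errors are at most `η`, so `η ≤ ρ ^ 2` puts `(x, a)` into the
  -- neighbourhood of the regularity condition.
  refine ⟨min 1 (ρ ^ 2), lt_min one_pos (pos_iff_ne_zero.2 (pow_ne_zero 2 hρ.ne')), K.toNNReal * (B + 1 + 1), ?_⟩
  intro x a hxa hx ha hnear
  have h1 : ∀ α : ℕ × ℕ, 1 ≤ α.1 + α.2 → α.1 + α.2 ≤ k + 1 →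
      M.nuisanceError μ i (2 * α.1, 2 * α.2) x a ≤ ρ := fun α h1 h2 => by
    have := (hnear.nuisanceError_sq_le hM hk (min_le_left _ _) hx ha h1 h2).trans (min_le_right _ _)
    exact (ENNReal.pow_le_pow_left_iff two_ne_zero).1 this
  have h2 := hB (x, a) hxa hx ha h1 (1, 0) (by simp)
  simp only [scoreDiff_one_zero] at h2
  -- The first-stage error of order `(0, k)` takes care of the lower powers in the weight.
  have h3 : ∫⁻ ω, ‖a (M.Z 0 ω) - M.prop i (M.Z 0 ω)‖ₑ ^ (4 * k) ∂μ ≤ 1 := by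
    have := (hnear (0, k) (by simpa using hk) (by simp)).trans (min_le_left _ _)
    rw [hM.nuisanceError_eq hx ha] at this
    simpa using this
  have hmA : Measurable fun ω =>
      ‖weightA (M.moment μ i) r k (M.treated i 0 ω) (a (M.Z 0 ω)) - 1‖ₑ ^ 4 := by
    have := hM.measurable_treated 0
    have := hM.measurable_Z 0
    unfold weightA
    fun_prop
  calc ∫⁻ ω, ENNReal.ofReal (|M.treated i 0 ω - a (M.Z 0 ω)| ^ (4 * r)) ∂μ
      ≤ ∫⁻ ω, K.toNNReal * ((‖weightA (M.moment μ i) r k (M.treated i 0 ω) (a (M.Z 0 ω)) - 1‖ₑ ^ 4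
          + 1) + ‖a (M.Z 0 ω) - M.prop i (M.Z 0 ω)‖ₑ ^ (4 * k)) ∂μ := by
        refine lintegral_mono_ae ?_
        filter_upwards [hM.abs_ν_le_one 0] with ω hω
        refine (ENNReal.ofReal_le_ofReal (hK _ _ _ hω)).trans_eq ?_
        rw [ENNReal.ofReal_mul hK0, ENNReal.ofReal_add (by positivity) (by positivity),
          ENNReal.ofReal_add (by positivity) (by positivity), ENNReal.ofReal_pow (abs_nonneg _),
          ENNReal.ofReal_pow (abs_nonneg _), ← Real.enorm_eq_ofReal_abs,
          ← Real.enorm_eq_ofReal_abs, ENNReal.ofReal_one]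
        rfl
    _ ≤ K.toNNReal * ((B + 1) + 1) := by
        rw [lintegral_const_mul' _ _ ENNReal.coe_ne_top, lintegral_add_left (by fun_prop),
          lintegral_add_left hmA]
        gcongr
        simp
    _ = _ := by push_cast; rfl

/-- The integrand that dominates all errors of the averages: `u` and `v` are the errors of the two
nuisance values, `w` is the size of the residual of the treatment, `s` that of the noise. -/
noncomputable def errorBound (r : ℕ) (u v w s : ℝ) : ℝ :=
  u ^ 2 + (u + v) * (1 + w ^ r) * (1 + s + (1 + w ^ r))

/-- With `L = 1 + w ^ r`, the errors `u + v` are small in `L⁴`, `L` is bounded in `L⁴`, and the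
noise is only in `L²`. Two uses of the Cauchy-Schwarz inequality bound the fourth power of `∫ (u +
v) L (1 + s + L)` by `∫ (u + v)⁴ · ∫ L⁴ · (∫ (1 + s + L)²)²`, which fits these integrabilities. -/
theorem Valid.exists_errorBound_le (hM : M.Valid μ i) {r k : ℕ} (hk : 1 ≤ k)
    (hmom : M.moment μ i r ≠ 0) {𝒯 : Set ((𝒵 → ℝ) × (𝒵 → ℝ))}
    (hreg : M.MomentsRegular μ i r k 𝒯) {ε : ℝ≥0∞} (hε : 0 < ε) :
    ∃ η : ℝ≥0∞, 0 < η ∧ ∀ x a : 𝒵 → ℝ, (x, a) ∈ 𝒯 → Measurable x → Measurable a →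
      M.IsNear μ i k η x a →
      ∫⁻ ω, ENNReal.ofReal (errorBound r |x (M.Z 0 ω) - M.g i (M.Z 0 ω)|
        |a (M.Z 0 ω) - M.prop i (M.Z 0 ω)| |M.treated i 0 ω - a (M.Z 0 ω)| |M.ξF i 0 ω|) ∂μ
        ≤ ε := by
  obtain ⟨η₀, hη₀, C, hC⟩ := hM.exists_moment_bound hk hmom hreg
  set Cs : ℝ≥0∞ := ∫⁻ ω, ‖M.ξF i 0 ω‖ₑ ^ 2 ∂μ with hCs
  have hCsf : Cs ≠ ∞ := by
    have := (hM.memLp_ξF 0).eLpNorm_lt_top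
    have h2 := (eLpNorm_lt_top_iff_lintegral_rpow_enorm_lt_top (p := 2) (by norm_num)
      (by norm_num)).1 this
    simp only [ENNReal.toReal_ofNat] at h2
    rw [hCs]
    refine ne_of_lt ?_
    convert h2 using 3 with ω
    norm_cast
  set CL : ℝ≥0∞ := 8 * (1 + C) with hCL
  have hCLf : CL ≠ ∞ := by simp [hCL, ENNReal.mul_eq_top]
  set CM : ℝ≥0∞ := 4 * (1 + Cs + (1 + CL)) with hCM
  have hCMf : CM ≠ ∞ := by
    simp only [hCM, ne_eq, ENNReal.mul_eq_top, ENNReal.add_eq_top, hCsf, hCLf]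
    simp
  set D : ℝ≥0∞ := 16 * CL * CM ^ 2 with hD
  have hDf : D ≠ ∞ := by
    simp only [hD]
    exact ENNReal.mul_ne_top (ENNReal.mul_ne_top (by simp) hCLf) (ENNReal.pow_ne_top hCMf)
  set e : ℝ≥0∞ := min (ε / 2) 1 with he
  have he0 : 0 < e := lt_min (ENNReal.half_pos hε.ne') one_pos
  -- The bound `e ^ 2` serves the term `u ^ 2`, and `e ^ 4 / (D + 1)` the product term, whose fourth
  -- power is at most `D * η`; the summand `1` keeps the denominator nonzero.
  refine ⟨min η₀ (min (e ^ 2) (e ^ 4 / (D + 1))), lt_min hη₀ (lt_min (pos_iff_ne_zero.2 (pow_ne_zero 2 he0.ne'))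
    (ENNReal.div_pos (pow_ne_zero 4 he0.ne') (by simp [hDf]))), ?_⟩
  intro x a hxa hx ha hnear
  have hV := hC x a hxa hx ha (hnear.mono (min_le_left _ _))
  set η := min η₀ (min (e ^ 2) (e ^ 4 / (D + 1)))
  have mg := hM.measurable_g i
  have mp := hM.measurable_prop i
  have mT := hM.measurable_treated 0
  have mZ := hM.measurable_Z 0
  have mξ := hM.measurable_ξF i 0
  set u : Ω → ℝ≥0∞ := fun ω => ‖x (M.Z 0 ω) - M.g i (M.Z 0 ω)‖ₑ with hu
  set v : Ω → ℝ≥0∞ := fun ω => ‖a (M.Z 0 ω) - M.prop i (M.Z 0 ω)‖ₑ with hv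
  set L : Ω → ℝ≥0∞ := fun ω => 1 + ‖M.treated i 0 ω - a (M.Z 0 ω)‖ₑ ^ r with hL
  set s : Ω → ℝ≥0∞ := fun ω => ‖M.ξF i 0 ω‖ₑ with hs
  have mu : Measurable u := by fun_prop
  have mv : Measurable v := by fun_prop
  have mL : Measurable L := by fun_prop
  have ms : Measurable s := by fun_prop
  have hu4 : ∫⁻ ω, u ω ^ 4 ∂μ ≤ η := by
    have := hnear (1, 0) (by simp) (by simpa using hk)
    rw [hM.nuisanceError_eq hx ha] at this
    simpa using this
  have hv4 : ∫⁻ ω, v ω ^ 4 ∂μ ≤ η := by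
    have := hnear (0, 1) (by simp) (by simpa using hk)
    rw [hM.nuisanceError_eq hx ha] at this
    simpa using this
  have hp4 : ∀ b c : ℝ≥0∞, (b + c) ^ 4 ≤ 8 * (b ^ 4 + c ^ 4) := by
    intro b c
    have := ENNReal.rpow_add_le_mul_rpow_add_rpow b c (p := 4) (by norm_num)
    norm_num at this
    exact_mod_cast this
  have hp2 : ∀ b c d : ℝ≥0∞, (b + c + d) ^ 2 ≤ 4 * (b ^ 2 + c ^ 2 + d ^ 2) := by
    intro b c d
    have h : ∀ b c : ℝ≥0∞, (b + c) ^ 2 ≤ 2 * (b ^ 2 + c ^ 2) := by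
      intro b c
      have := ENNReal.rpow_add_le_mul_rpow_add_rpow b c (p := 2) (by norm_num)
      norm_num at this
      exact_mod_cast this
    calc (b + c + d) ^ 2 ≤ 2 * ((b + c) ^ 2 + d ^ 2) := h _ _
      _ ≤ 2 * (2 * (b ^ 2 + c ^ 2) + 2 * d ^ 2) := by
          gcongr
          · exact h b c
          · exact le_mul_of_one_le_left' one_le_two
      _ = 4 * (b ^ 2 + c ^ 2 + d ^ 2) := by ring
  have hL4 : ∫⁻ ω, L ω ^ 4 ∂μ ≤ CL := by
    calc _ ≤ ∫⁻ ω, 8 * (1 + ENNReal.ofReal (|M.treated i 0 ω - a (M.Z 0 ω)| ^ (4 * r))) ∂μ := by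
          refine lintegral_mono fun ω => (hp4 _ _).trans_eq ?_
          rw [ENNReal.ofReal_pow (abs_nonneg _), ← Real.enorm_eq_ofReal_abs]
          ring
      _ ≤ CL := by
          rw [lintegral_const_mul' _ _ (by simp), lintegral_add_left measurable_const, hCL]
          gcongr
          simp
  have hL2 : ∫⁻ ω, L ω ^ 2 ∂μ ≤ 1 + CL := by
    calc _ ≤ ∫⁻ ω, (1 + L ω ^ 4) ∂μ := by
          refine lintegral_mono fun ω => ?_
          have : 1 ≤ L ω := by simp [hL]
          exact (pow_le_pow_right₀ this (by norm_num)).trans le_add_self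
      _ ≤ _ := by
          rw [lintegral_add_left measurable_const]
          gcongr
          simp
  have hM2 : ∫⁻ ω, (1 + s ω + L ω) ^ 2 ∂μ ≤ CM := by
    calc _ ≤ ∫⁻ ω, 4 * (1 ^ 2 + s ω ^ 2 + L ω ^ 2) ∂μ := lintegral_mono fun ω => hp2 _ _ _
      _ ≤ CM := by
          rw [lintegral_const_mul' _ _ (by simp), lintegral_add_left (by fun_prop),
            lintegral_add_left (by fun_prop), hCM]
          refine mul_le_mul' le_rfl (add_le_add (add_le_add ?_ le_rfl) hL2)
          simp
  have huv : ∫⁻ ω, (u ω + v ω) ^ 4 ∂μ ≤ 16 * η := by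
    calc _ ≤ ∫⁻ ω, 8 * (u ω ^ 4 + v ω ^ 4) ∂μ := lintegral_mono fun ω => hp4 _ _
      _ ≤ 8 * (η + η) := by
          rw [lintegral_const_mul' _ _ (by simp), lintegral_add_left (by fun_prop)]
          gcongr
      _ = 16 * η := by ring
  have b1 : ∫⁻ ω, u ω ^ 2 ∂μ ≤ e := by
    have cs := lintegral_mul_sq_le (μ := μ) (f := fun ω => u ω ^ 2) (g := fun _ => 1)
      (by fun_prop) (by fun_prop)
    simp only [mul_one, one_pow, lintegral_const, measure_univ, ← pow_mul] at cs
    exact (ENNReal.pow_le_pow_left_iff two_ne_zero).1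
      (cs.trans (hu4.trans ((min_le_right _ _).trans (min_le_left _ _))))
  have b2 : ∫⁻ ω, (u ω + v ω) * L ω * (1 + s ω + L ω) ∂μ ≤ e := by
    have cs1 := lintegral_mul_sq_le (μ := μ) (f := fun ω => (u ω + v ω) * L ω)
      (g := fun ω => 1 + s ω + L ω) (by fun_prop) (by fun_prop)
    have cs2 := lintegral_mul_sq_le (μ := μ) (f := fun ω => (u ω + v ω) ^ 2)
      (g := fun ω => L ω ^ 2) (by fun_prop) (by fun_prop)
    simp only [← pow_mul, ← mul_pow] at cs2
    refine (ENNReal.pow_le_pow_left_iff four_ne_zero).1 ?_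
    calc (∫⁻ ω, (u ω + v ω) * L ω * (1 + s ω + L ω) ∂μ) ^ 4
        = ((∫⁻ ω, (u ω + v ω) * L ω * (1 + s ω + L ω) ∂μ) ^ 2) ^ 2 := by ring
      _ ≤ ((∫⁻ ω, ((u ω + v ω) * L ω) ^ 2 ∂μ) * ∫⁻ ω, (1 + s ω + L ω) ^ 2 ∂μ) ^ 2 := by gcongr
      _ = (∫⁻ ω, ((u ω + v ω) * L ω) ^ 2 ∂μ) ^ 2 * (∫⁻ ω, (1 + s ω + L ω) ^ 2 ∂μ) ^ 2 :=
          mul_pow _ _ _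
      _ ≤ ((16 * η) * CL) * CM ^ 2 := by
          gcongr
          exact cs2.trans (mul_le_mul' huv hL4)
      _ = D * η := by rw [hD]; ring
      _ ≤ (D + 1) * (e ^ 4 / (D + 1)) := by
          gcongr
          · exact le_self_add
          · exact (min_le_right _ _).trans (min_le_right _ _)
      _ = e ^ 4 := ENNReal.mul_div_cancel (by simp) (by simp [hDf])
  calc _ = ∫⁻ ω, (u ω ^ 2 + (u ω + v ω) * L ω * (1 + s ω + L ω)) ∂μ := by
        refine lintegral_congr fun ω => ?_
        simp only [errorBound, hu, hv, hL, hs, Real.enorm_eq_ofReal_abs]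
        rw [ENNReal.ofReal_add (by positivity) (by positivity), ENNReal.ofReal_pow (abs_nonneg _),
          ENNReal.ofReal_mul (by positivity), ENNReal.ofReal_mul (by positivity),
          ENNReal.ofReal_add (by positivity) (by positivity),
          ENNReal.ofReal_add (by positivity) (by positivity),
          ENNReal.ofReal_add (by positivity) (by positivity),
          ENNReal.ofReal_add zero_le_one (by positivity),
          ENNReal.ofReal_add zero_le_one (by positivity),
          ENNReal.ofReal_pow (abs_nonneg _), ENNReal.ofReal_one]
    _ ≤ e + e := by
        rw [lintegral_add_left (by fun_prop)]
        exact add_le_add b1 b2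
    _ ≤ ε / 2 + ε / 2 := by gcongr <;> exact min_le_left _ _
    _ = ε := ENNReal.add_halves ε

end Stability


/-! ### Elementary inequalities for the dominating integrand. -/

section Bounds

variable {u v w s : ℝ} {r : ℕ}

theorem errorBound_eq : errorBound r u v w s = u ^ 2 + (u + v) * (1 + w ^ r)
    + (u + v) * (1 + w ^ r) * s + (u + v) * (1 + w ^ r) * (1 + w ^ r) := by
  unfold errorBound; ring

/-- The five quantities arise, in this order, from the averages of `ĝ`, of the weighted residuals,
of the powers, of the squared powers, and of the squared residuals. -/
theorem le_errorBound (hu : 0 ≤ u) (hv : 0 ≤ v) (hw : 0 ≤ w) (hs : 0 ≤ s) :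
    u ≤ errorBound r u v w s ∧ u * (1 + w ^ r) + s * (v * (1 + w ^ r)) ≤ errorBound r u v w s ∧
      v * (1 + w ^ r) ≤ errorBound r u v w s ∧ v * (1 + w ^ r) ^ 2 ≤ errorBound r u v w s ∧
      u ^ 2 + 2 * (s * u) ≤ 2 * errorBound r u v w s := by
  rw [errorBound_eq]
  have hL : 1 ≤ 1 + w ^ r := by simp [pow_nonneg hw]
  set L := 1 + w ^ r
  have h1 : 0 ≤ u * L := by positivity
  have h2 : 0 ≤ v * L := by positivity
  have h3 : u ≤ u * L := le_mul_of_one_le_right hu hL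
  have h4 : 0 ≤ u * L * s := by positivity
  have h5 : 0 ≤ v * L * s := by positivity
  have h6 : 0 ≤ u * L * L := by positivity
  have h7 : 0 ≤ v * L * L := by positivity
  have h8 : s * u ≤ s * (u * L) := by gcongr
  have h9 : 0 ≤ u ^ 2 := by positivity
  refine ⟨?_, ?_, ?_, ?_, ?_⟩ <;> nlinarith

/-- In the factorization of `V ^ q - c ^ q` by `V - c`, each of the `q` terms of the cofactor is at
most `1 + |V| ^ r`. It serves for `V = 1_D - a` and `c = ν`, whose difference is the error of the
propensity score. -/
theorem abs_pow_sub_pow_le {V c : ℝ} (hc : |c| ≤ 1) {q : ℕ} (hq : q ≤ r) :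
    |V ^ q - c ^ q| ≤ r * (|V - c| * (1 + |V| ^ r)) := by
  have h := (Commute.all V c).geom_sum₂_mul q
  rw [← h, abs_mul]
  have h1 : |∑ j ∈ Finset.range q, V ^ j * c ^ (q - 1 - j)| ≤ r * (1 + |V| ^ r) := by
    refine (Finset.abs_sum_le_sum_abs _ _).trans ?_
    calc _ ≤ ∑ j ∈ Finset.range q, (1 + |V| ^ r) := by
          refine Finset.sum_le_sum fun j hj => ?_
          rw [abs_mul, abs_pow, abs_pow]
          have h2 := pow_le_one_add_pow (abs_nonneg V) ((Finset.mem_range.1 hj).le.trans hq)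
          exact (mul_le_of_le_one_right (by positivity) (pow_le_one₀ (abs_nonneg _) hc)).trans h2
      _ = q * (1 + |V| ^ r) := by rw [Finset.sum_const, Finset.card_range, nsmul_eq_mul]
      _ ≤ _ := by gcongr
  calc _ ≤ r * (1 + |V| ^ r) * |V - c| := by gcongr
    _ = _ := by ring

end Bounds

/-! ### Limits of the averages over the sample. -/

variable {Ω 𝒵 : Type*} [MeasurableSpace Ω] [MeasurableSpace 𝒵] {n : ℕ}

/-- The standing assumptions on the model, on the split of the sample, and on the training
procedures. -/
structure TrainedNuisance (M : CausalModel Ω 𝒵 n) (μ : Measure Ω) (i : Fin n) (r k : ℕ)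
    (I Ic : ℕ → Finset ℕ) (gTrain πTrain : (N : ℕ) → (Ic N → ℝ × Fin n × 𝒵) → 𝒵 → ℝ)
    (𝒯 : Set ((𝒵 → ℝ) × (𝒵 → ℝ))) : Prop where
  valid : M.Valid μ i
  two_le : 2 ≤ k
  le : k ≤ r
  moment_ne : M.moment μ i r ≠ 0
  card : ∀ N, (I N).card = N
  disjoint : ∀ N, Disjoint (I N) (Ic N)
  measurable_g : ∀ N, Measurable (Function.uncurry (gTrain N))
  measurable_π : ∀ N, Measurable (Function.uncurry (πTrain N))
  mem : ∀ N, ∀ᵐ ω ∂μ, (M.trained (gTrain N) ω, M.trained (πTrain N) ω) ∈ 𝒯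
  consistent : M.FirstStageConsistent μ i k
      (fun N ω => M.trained (gTrain N) ω) (fun N ω => M.trained (πTrain N) ω)
  regular : M.MomentsRegular μ i r k 𝒯

variable {M : CausalModel Ω 𝒵 n} {μ : Measure Ω} {i : Fin n} {r k : ℕ}
    {I Ic : ℕ → Finset ℕ} {gTrain πTrain : (N : ℕ) → (Ic N → ℝ × Fin n × 𝒵) → 𝒵 → ℝ}
    {𝒯 : Set ((𝒵 → ℝ) × (𝒵 → ℝ))}

/-- The trained functions are eventually near the true ones, with high probability. -/
theorem FirstStageConsistent.tendsto_not_isNear {gHat πHat : ℕ → Ω → 𝒵 → ℝ}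
    (h : M.FirstStageConsistent μ i k gHat πHat) {η : ℝ≥0∞} (hη : 0 < η) :
    Tendsto (fun N => μ {ω | ¬ M.IsNear μ i k η (gHat N ω) (πHat N ω)}) atTop (𝓝 0) := by
  set F := (Finset.range (k + 1) ×ˢ Finset.range (k + 1)).filter
    fun α => 1 ≤ α.1 + α.2 ∧ α.1 + α.2 ≤ k
  have h0 : Tendsto (fun N => ∑ α ∈ F,
      μ {ω | η ≤ M.nuisanceError μ i (4 * α.1, 4 * α.2) (gHat N ω) (πHat N ω)}) atTop (𝓝 0) := by
    rw [← Finset.sum_const_zero (s := F)]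
    refine tendsto_finsetSum F fun α hα => ?_
    have := (Finset.mem_filter.1 hα).2
    exact h α this.1 this.2 η hη
  refine tendsto_of_tendsto_of_tendsto_of_le_of_le tendsto_const_nhds h0
    (fun _ => zero_le) fun N => ?_
  refine (measure_mono fun ω hω => ?_).trans (measure_biUnion_finset_le F _)
  simp only [IsNear, Set.mem_ofPred_eq, not_forall, not_le] at hω
  obtain ⟨α, h1, h2, h3⟩ := hω
  refine Set.mem_biUnion (x := α) ?_ h3.le
  simp only [F, Finset.coe_filter, Set.mem_ofPred_eq, Finset.mem_product, Finset.mem_range]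
  omega

variable [IsProbabilityMeasure μ]

/-- A pointwise comparison with `errorBound` suffices for the weak law with trained functions. The
restriction to `|ν| ≤ 1` costs only a null set. -/
theorem TrainedNuisance.tendstoInMeasure_average
    (T : M.TrainedNuisance μ i r k I Ic gTrain πTrain 𝒯)
    {Φ : ℝ × ℝ × Individual 𝒵 n → ℝ} (hΦ : Measurable Φ)
    (hint : Integrable (fun ω => Φ (M.g i (M.Z 0 ω), M.prop i (M.Z 0 ω), M.individual 0 ω)) μ)
    (K : ℝ) (hK : 0 ≤ K)
    (hbound : ∀ (x a : ℝ) (ω : Ω), |M.ν i 0 ω| ≤ 1 →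
      |Φ (x, a, M.individual 0 ω) - Φ (M.g i (M.Z 0 ω), M.prop i (M.Z 0 ω), M.individual 0 ω)| ≤
        K * errorBound r |x - M.g i (M.Z 0 ω)| |a - M.prop i (M.Z 0 ω)| |M.treated i 0 ω - a|
          |M.ξF i 0 ω|) :
    TendstoInMeasure μ (fun (N : ℕ) ω => (1 / (N : ℝ)) * ∑ m ∈ I N,
        Φ (M.trained (gTrain N) ω (M.Z m ω), M.trained (πTrain N) ω (M.Z m ω), M.individual m ω))
      atTop fun _ => ∫ ω, Φ (M.g i (M.Z 0 ω), M.prop i (M.Z 0 ω), M.individual 0 ω) ∂μ := by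
  refine T.valid.tendstoInMeasure_average T.card T.disjoint T.measurable_g T.measurable_π hΦ hint ?_
  intro ε hε
  have hε' : 0 < ε / ENNReal.ofReal (K + 1) := ENNReal.div_pos hε.ne' ENNReal.ofReal_ne_top
  obtain ⟨η, hη, H⟩ := T.valid.exists_errorBound_le (by have := T.two_le; omega) T.moment_ne
    T.regular hε'
  refine tendsto_of_tendsto_of_tendsto_of_le_of_le tendsto_const_nhds
    (T.consistent.tendsto_not_isNear hη) (fun _ => zero_le) fun N => ?_
  refine measure_mono_ae ?_
  filter_upwards [T.mem N] with ω hω hlt hnear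
  refine absurd hlt (not_lt.2 ?_)
  have mx : Measurable (M.trained (gTrain N) ω) :=
    (T.measurable_g N).of_uncurry_left (x := fun m : Ic N => M.obs m ω)
  have ma : Measurable (M.trained (πTrain N) ω) :=
    (T.measurable_π N).of_uncurry_left (x := fun m : Ic N => M.obs m ω)
  have h1 := H _ _ hω mx ma hnear
  set x := M.trained (gTrain N) ω
  set a := M.trained (πTrain N) ω
  calc _ ≤ ∫⁻ ω', ENNReal.ofReal (K + 1) * ENNReal.ofReal (errorBound r
          |x (M.Z 0 ω') - M.g i (M.Z 0 ω')| |a (M.Z 0 ω') - M.prop i (M.Z 0 ω')|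
          |M.treated i 0 ω' - a (M.Z 0 ω')| |M.ξF i 0 ω'|) ∂μ := by
        refine lintegral_mono_ae ?_
        filter_upwards [T.valid.abs_ν_le_one 0] with ω' hν
        rw [← ENNReal.ofReal_mul (by positivity), Real.enorm_eq_ofReal_abs]
        refine ENNReal.ofReal_le_ofReal ((hbound _ _ ω' hν).trans ?_)
        gcongr
        · unfold errorBound; positivity
        · linarith
    _ = ENNReal.ofReal (K + 1) * _ := lintegral_const_mul' _ _ ENNReal.ofReal_ne_top
    _ ≤ ENNReal.ofReal (K + 1) * (ε / ENNReal.ofReal (K + 1)) := by gcongr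
    _ ≤ ε := ENNReal.mul_div_le

/-- `1_{D = dⁱ}` as a function of the individual. -/
noncomputable def treatedOf (i : Fin n) (y : Individual 𝒵 n) : ℝ := if y.2.1 = i then 1 else 0

theorem measurable_treatedOf : Measurable (treatedOf (𝒵 := 𝒵) i) :=
  Measurable.ite ((measurable_fst.comp measurable_snd) (measurableSet_singleton i))
    measurable_const measurable_const

omit [MeasurableSpace Ω] [MeasurableSpace 𝒵] in
theorem treatedOf_individual (m : ℕ) (ω : Ω) :
    treatedOf i (M.individual m ω) = M.treated i m ω := rfl

omit [MeasurableSpace Ω] [MeasurableSpace 𝒵] in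
theorem treated_eq_zero_or_one (m : ℕ) (ω : Ω) :
    M.treated i m ω = 0 ∨ M.treated i m ω = 1 := by
  unfold treated; split_ifs <;> simp

omit [MeasurableSpace Ω] [MeasurableSpace 𝒵] in
theorem treated_mul_observed (m : ℕ) (ω : Ω) :
    M.treated i m ω * M.observed m ω
      = M.treated i m ω * (M.g i (M.Z m ω) + M.ξF i m ω) := by
  by_cases h : M.D m ω = i
  · simp [treated, observed, outcome, h]
  · simp [treated, h]

theorem Valid.integrable_of_abs_le (hM : M.Valid μ i) {f : Ω → ℝ} (hf : Measurable f)
    (h : ∀ ω, |M.ν i 0 ω| ≤ 1 → |f ω| ≤ 1) : Integrable f μ :=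
  Integrable.of_bound hf.aestronglyMeasurable 1 <| by
    filter_upwards [hM.abs_ν_le_one 0] with ω hω using h ω hω

omit [MeasurableSpace Ω] [MeasurableSpace 𝒵] in
theorem abs_treated_sub_pow_le {q r' : ℕ} (hq : q ≤ r') {ω : Ω} (hν : |M.ν i 0 ω| ≤ 1) (a : ℝ) :
    |(M.treated i 0 ω - a) ^ q - M.ν i 0 ω ^ q| ≤
      r' * (|a - M.prop i (M.Z 0 ω)| * (1 + |M.treated i 0 ω - a| ^ r')) := by
  have h := abs_pow_sub_pow_le (V := M.treated i 0 ω - a) hν hq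
  have e : |M.treated i 0 ω - a - M.ν i 0 ω| = |a - M.prop i (M.Z 0 ω)| := by
    rw [abs_sub_comm, ν]; congr 1; ring
  rwa [e] at h

namespace TrainedNuisance

variable (T : M.TrainedNuisance μ i r k I Ic gTrain πTrain 𝒯)
include T

theorem tendsto_average_g :
    TendstoInMeasure μ (fun (N : ℕ) ω => (1 / (N : ℝ)) * ∑ m ∈ I N,
      M.trained (gTrain N) ω (M.Z m ω)) atTop fun _ => M.θ μ i := by
  refine T.tendstoInMeasure_average (Φ := fun p => p.1) measurable_fst T.valid.integrable_g 1
    zero_le_one fun x a ω hν => ?_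
  rw [one_mul]
  exact (le_errorBound (abs_nonneg _) (abs_nonneg _) (abs_nonneg _) (abs_nonneg _)).1

/-- The factor `1_D` allows the observed outcome to be replaced by `g(Z) + ξF` throughout, so that
the summand depends on one individual and the trained functions; the limit is then the weighted mean
of the noise, which vanishes. -/
theorem tendsto_average_residual {q : ℕ} (hq : q ≤ r) :
    TendstoInMeasure μ (fun (N : ℕ) ω => (1 / (N : ℝ)) * ∑ m ∈ I N,
      M.treated i m ω * (M.observed m ω - M.trained (gTrain N) ω (M.Z m ω))
        * (M.treated i m ω - M.trained (πTrain N) ω (M.Z m ω)) ^ q) atTop fun _ => 0 := by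
  have hM := T.valid
  have mg := hM.measurable_g i
  have mt := measurable_treatedOf (𝒵 := 𝒵) (i := i)
  have mξ := hM.measurable_ξF i 0
  have mν := hM.measurable_ν 0
  have mT := hM.measurable_treated 0
  have h := T.tendstoInMeasure_average
    (Φ := fun p => treatedOf i p.2.2 * (M.g i p.2.2.1 + p.2.2.2.2.1 i - p.1)
      * (treatedOf i p.2.2 - p.2.1) ^ q) (by fun_prop) ?_ (1 + r) (by positivity) ?_
  · convert h using 4 with N ω
    · refine Finset.sum_congr rfl fun m _ => ?_
      simp only [treatedOf_individual]
      rw [mul_sub, treated_mul_observed, ← mul_sub]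
      rfl
    · rw [← hM.integral_treated_mul_noise 0 q]
      refine integral_congr_ae (.of_forall fun ω => ?_)
      by_cases hD : M.D 0 ω = i <;> simp [treatedOf, treated, individual, ν, hD]
  · have hb : Integrable (fun ω => M.ξF i 0 ω * (M.treated i 0 ω * M.ν i 0 ω ^ q)) μ := by
      refine (hM.integrable_ξF 0).mul_bdd (c := 1) (by fun_prop) ?_
      filter_upwards [hM.abs_ν_le_one 0] with ω hν
      rw [norm_mul, norm_pow, Real.norm_eq_abs, Real.norm_eq_abs]
      refine mul_le_one₀ ?_ (by positivity) (pow_le_one₀ (abs_nonneg _) hν)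
      rcases treated_eq_zero_or_one (M := M) (i := i) 0 ω with h | h <;> simp [h]
    refine hb.congr (.of_forall fun ω => ?_)
    by_cases hD : M.D 0 ω = i <;> simp [treatedOf, treated, individual, ν, hD]
  · intro x a ω hν
    have hE := (le_errorBound (r := r) (abs_nonneg (x - M.g i (M.Z 0 ω)))
      (abs_nonneg (a - M.prop i (M.Z 0 ω))) (abs_nonneg (M.treated i 0 ω - a))
      (abs_nonneg (M.ξF i 0 ω))).2.1
    have h1 := abs_treated_sub_pow_le hq hν a
    have h2 := pow_le_one_add_pow (abs_nonneg (M.treated i 0 ω - a)) hq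
    -- The error is separated into a contribution of `x`, free of noise, and one of `a`, multiplied
    -- by the noise.
    have e : M.treated i 0 ω * (M.g i (M.Z 0 ω) + M.ξF i 0 ω - x) * (M.treated i 0 ω - a) ^ q
        - M.treated i 0 ω * (M.g i (M.Z 0 ω) + M.ξF i 0 ω - M.g i (M.Z 0 ω)) * M.ν i 0 ω ^ q
        = M.treated i 0 ω * (-((x - M.g i (M.Z 0 ω)) * (M.treated i 0 ω - a) ^ q)
          + M.ξF i 0 ω * ((M.treated i 0 ω - a) ^ q - M.ν i 0 ω ^ q)) := by ring
    refine le_trans (le_of_eq (congrArg abs e)) ?_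
    rw [abs_mul, abs_of_nonneg (treated_nonneg 0 ω)]
    refine (mul_le_of_le_one_left (abs_nonneg _) (treated_le_one 0 ω)).trans ?_
    refine (abs_add_le _ _).trans ?_
    rw [abs_neg, abs_mul, abs_mul, abs_pow]
    set u := |x - M.g i (M.Z 0 ω)|
    set v := |a - M.prop i (M.Z 0 ω)|
    set L := 1 + |M.treated i 0 ω - a| ^ r
    have hu : 0 ≤ u := abs_nonneg _
    have hv : 0 ≤ v := abs_nonneg _
    have hL : 0 ≤ L := by positivity
    calc _ ≤ u * L + |M.ξF i 0 ω| * (r * (v * L)) := by gcongr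
      _ ≤ (1 + r) * (u * L + |M.ξF i 0 ω| * (v * L)) := by
          have : 0 ≤ |M.ξF i 0 ω| * (v * L) := by positivity
          have : 0 ≤ r * (u * L) := by positivity
          nlinarith
      _ ≤ _ := by gcongr

theorem tendsto_average_pow {q : ℕ} (hq : q ≤ r) :
    TendstoInMeasure μ (fun (N : ℕ) ω => (1 / (N : ℝ)) * ∑ m ∈ I N,
      (M.treated i m ω - M.trained (πTrain N) ω (M.Z m ω)) ^ q) atTop
      fun _ => M.moment μ i q := by
  have mt := measurable_treatedOf (𝒵 := 𝒵) (i := i)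
  have mν := T.valid.measurable_ν 0
  refine T.tendstoInMeasure_average (Φ := fun p => (treatedOf i p.2.2 - p.2.1) ^ q)
    (by fun_prop) (T.valid.integrable_of_abs_le (mν.pow_const q) fun ω hν => ?_) r
    (by positivity) fun x a ω hν => ?_
  · rw [abs_pow]; exact pow_le_one₀ (abs_nonneg _) hν
  · refine (abs_treated_sub_pow_le hq hν a).trans ?_
    gcongr
    exact (le_errorBound (abs_nonneg _) (abs_nonneg _) (abs_nonneg _) (abs_nonneg _)).2.2.1

/-- Only the finiteness of the limit matters, as this average is multiplied by the mean residual,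
which tends to zero. -/
theorem tendsto_average_untreated_pow {q : ℕ} (hq : q ≤ r) :
    TendstoInMeasure μ (fun (N : ℕ) ω => (1 / (N : ℝ)) * ∑ m ∈ I N,
      (1 - M.treated i m ω) * (M.treated i m ω - M.trained (πTrain N) ω (M.Z m ω)) ^ q) atTop
      fun _ => ∫ ω, (1 - M.treated i 0 ω) * M.ν i 0 ω ^ q ∂μ := by
  have mt := measurable_treatedOf (𝒵 := 𝒵) (i := i)
  have mν := T.valid.measurable_ν 0
  have mT := T.valid.measurable_treated 0
  have h01 : ∀ ω, |1 - M.treated i 0 ω| ≤ 1 := fun ω => by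
    rcases treated_eq_zero_or_one (M := M) (i := i) 0 ω with h | h <;> simp [h]
  refine T.tendstoInMeasure_average
    (Φ := fun p => (1 - treatedOf i p.2.2) * (treatedOf i p.2.2 - p.2.1) ^ q) (by fun_prop)
    (T.valid.integrable_of_abs_le (f := fun ω => (1 - M.treated i 0 ω) * M.ν i 0 ω ^ q)
      (by fun_prop) fun ω hν => ?_) r (by positivity) fun x a ω hν => ?_
  · rw [abs_mul, abs_pow]
    exact mul_le_one₀ (h01 ω) (by positivity) (pow_le_one₀ (abs_nonneg _) hν)
  · simp only [treatedOf_individual]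
    rw [← mul_sub, abs_mul]
    refine (mul_le_of_le_one_left (abs_nonneg _) (h01 ω)).trans ?_
    refine (abs_treated_sub_pow_le hq hν a).trans ?_
    gcongr
    exact (le_errorBound (abs_nonneg _) (abs_nonneg _) (abs_nonneg _) (abs_nonneg _)).2.2.1

/-- Together with `tendsto_average_residual_sq`, this keeps the variance factor in Chebyshev's
inequality for the resampled term bounded in probability. -/
theorem tendsto_average_sq {q : ℕ} (hq : q ≤ r) :
    TendstoInMeasure μ (fun (N : ℕ) ω => (1 / (N : ℝ)) * ∑ m ∈ I N,
      ((M.treated i m ω - M.trained (πTrain N) ω (M.Z m ω)) ^ q) ^ 2) atTop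
      fun _ => ∫ ω, (M.ν i 0 ω ^ q) ^ 2 ∂μ := by
  have mt := measurable_treatedOf (𝒵 := 𝒵) (i := i)
  have mν := T.valid.measurable_ν 0
  refine T.tendstoInMeasure_average (Φ := fun p => ((treatedOf i p.2.2 - p.2.1) ^ q) ^ 2)
    (by fun_prop) (T.valid.integrable_of_abs_le (f := fun ω => (M.ν i 0 ω ^ q) ^ 2)
      (by fun_prop) fun ω hν => ?_) (2 * r) (by positivity) fun x a ω hν => ?_
  · rw [abs_pow, abs_pow]; exact pow_le_one₀ (by positivity) (pow_le_one₀ (abs_nonneg _) hν)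
  · have h := abs_treated_sub_pow_le (q := q * 2) (r' := r * 2) (by omega) hν a
    rw [pow_mul, pow_mul, pow_mul] at h
    refine h.trans ?_
    have hE := (le_errorBound (r := r) (abs_nonneg (x - M.g i (M.Z 0 ω)))
      (abs_nonneg (a - M.prop i (M.Z 0 ω))) (abs_nonneg (M.treated i 0 ω - a))
      (abs_nonneg (M.ξF i 0 ω))).2.2.2.1
    push_cast
    rw [mul_comm (r : ℝ) 2]
    gcongr
    refine le_trans ?_ hE
    gcongr
    nlinarith [pow_nonneg (abs_nonneg (M.treated i 0 ω - a)) r]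

theorem tendsto_average_residual_sq :
    TendstoInMeasure μ (fun (N : ℕ) ω => (1 / (N : ℝ)) * ∑ m ∈ I N,
      M.treated i m ω * (M.observed m ω - M.trained (gTrain N) ω (M.Z m ω)) ^ 2) atTop
      fun _ => ∫ ω, M.treated i 0 ω * M.ξF i 0 ω ^ 2 ∂μ := by
  have hM := T.valid
  have mg := hM.measurable_g i
  have mt := measurable_treatedOf (𝒵 := 𝒵) (i := i)
  have mT := hM.measurable_treated 0
  have h := T.tendstoInMeasure_average
    (Φ := fun p => treatedOf i p.2.2 * (M.g i p.2.2.1 + p.2.2.2.2.1 i - p.1) ^ 2)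
    (by fun_prop) ?_ 2 (by positivity) ?_
  · convert h using 4 with N ω
    · refine Finset.sum_congr rfl fun m _ => ?_
      by_cases hD : M.D m ω = i
      · simp [treatedOf, treated, individual, observed, outcome, hD]
      · simp [treatedOf, treated, individual, hD]
    · rename_i ω
      by_cases hD : M.D 0 ω = i <;> simp [treatedOf, treated, individual, hD]
  · have hb : Integrable (fun ω => M.ξF i 0 ω ^ 2 * M.treated i 0 ω) μ := by
      refine (hM.memLp_ξF 0).integrable_sq.mul_bdd (c := 1) (by fun_prop) (.of_forall fun ω => ?_)
      rcases treated_eq_zero_or_one (M := M) (i := i) 0 ω with h | h <;> simp [h]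
    refine hb.congr (.of_forall fun ω => ?_)
    by_cases hD : M.D 0 ω = i <;> simp [treatedOf, treated, individual, hD]
  · intro x a ω hν
    have hE := (le_errorBound (r := r) (abs_nonneg (x - M.g i (M.Z 0 ω)))
      (abs_nonneg (a - M.prop i (M.Z 0 ω))) (abs_nonneg (M.treated i 0 ω - a))
      (abs_nonneg (M.ξF i 0 ω))).2.2.2.2
    have e : M.treated i 0 ω * (M.g i (M.Z 0 ω) + M.ξF i 0 ω - x) ^ 2
        - M.treated i 0 ω * (M.g i (M.Z 0 ω) + M.ξF i 0 ω - M.g i (M.Z 0 ω)) ^ 2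
        = M.treated i 0 ω * ((x - M.g i (M.Z 0 ω)) ^ 2
          - 2 * (M.ξF i 0 ω * (x - M.g i (M.Z 0 ω)))) := by ring
    refine le_trans (le_of_eq (congrArg abs e)) ?_
    rw [abs_mul, abs_of_nonneg (treated_nonneg 0 ω)]
    refine (mul_le_of_le_one_left (abs_nonneg _) (treated_le_one 0 ω)).trans
      ((abs_sub _ _).trans (le_trans (le_of_eq ?_) hE))
    rw [abs_pow, abs_mul, abs_mul, abs_two]

theorem tendsto_average_treated :
    TendstoInMeasure μ (fun (N : ℕ) ω => (1 / (N : ℝ)) * ∑ m ∈ I N, M.treated i m ω) atTop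
      fun _ => ∫ ω, M.treated i 0 ω ∂μ := by
  refine T.tendstoInMeasure_average (Φ := fun p => treatedOf i p.2.2)
    (measurable_treatedOf.comp (measurable_snd.comp measurable_snd))
    (T.valid.integrable_treated 0) 0 le_rfl fun x a ω _ => ?_
  simp

end TrainedNuisance

end CausalModel

/-! ### Counting form of Chebyshev's inequality for uniform picks. -/

section UniformPicks

variable {ι : Type*} [Fintype ι] [DecidableEq ι]

/-- The variance of a weighted sum of independent uniform picks. -/
theorem sum_piFinset_sq (P : Finset ℕ) (c : ι → ℝ) (d : ℕ → ℝ) (hd : ∑ j ∈ P, d j = 0) :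
    (P.card : ℝ) * ∑ j ∈ Fintype.piFinset fun _ : ι => P, (∑ p, c p * d (j p)) ^ 2
      = (P.card : ℝ) ^ Fintype.card ι * ((∑ p, c p ^ 2) * ∑ j ∈ P, d j ^ 2) := by
  have hprod : ∀ f : ι → ℕ → ℝ, ∑ j ∈ Fintype.piFinset fun _ : ι => P, ∏ s, f s (j s)
      = ∏ s, ∑ j ∈ P, f s j := fun f => (Finset.prod_univ_sum _ _).symm
  -- Written as a product over all coordinates, the summand makes the sum over tuples factor, and
  -- the factor at `p` is `∑ d = 0`.
  have hoff : ∀ p p' : ι, p ≠ p' →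
      ∑ j ∈ Fintype.piFinset fun _ : ι => P, d (j p) * d (j p') = 0 := by
    intro p p' hpp
    have h := hprod fun s j => (if s = p then d j else 1) * (if s = p' then d j else 1)
    simp only [Finset.prod_mul_distrib, Finset.prod_ite_eq', Finset.mem_univ, if_true] at h
    rw [h]
    refine Finset.prod_eq_zero (Finset.mem_univ p) ?_
    simpa [hpp] using hd
  -- The coordinates other than `p` contribute `card ι - 1` factors `P.card`; the extra factor on
  -- the left avoids that subtraction.
  have hdiag : ∀ p : ι, (P.card : ℝ) * ∑ j ∈ Fintype.piFinset fun _ : ι => P, d (j p) * d (j p)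
      = (P.card : ℝ) ^ Fintype.card ι * ∑ j ∈ P, d j ^ 2 := by
    intro p
    have h := hprod fun s j => if s = p then d j ^ 2 else 1
    simp only [Finset.prod_ite_eq', Finset.mem_univ, if_true] at h
    simp only [← pow_two]
    rw [h, ← Finset.mul_prod_erase _ _ (Finset.mem_univ p)]
    have h2 : ∏ s ∈ Finset.univ.erase p, ∑ j ∈ P, (if s = p then d j ^ 2 else (1 : ℝ))
        = (P.card : ℝ) ^ (Fintype.card ι - 1) := by
      rw [Finset.prod_congr rfl (g := fun _ => (P.card : ℝ)) fun s hs => by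
        simp [Finset.ne_of_mem_erase hs]]
      simp [Finset.card_erase_of_mem]
    rw [h2]
    have hpos : 0 < Fintype.card ι := Fintype.card_pos_iff.2 ⟨p⟩
    obtain ⟨t, ht⟩ := Nat.exists_eq_succ_of_ne_zero hpos.ne'
    rw [ht]
    simp [pow_succ]
    ring
  calc (P.card : ℝ) * ∑ j ∈ Fintype.piFinset fun _ : ι => P, (∑ p, c p * d (j p)) ^ 2
      = ∑ p, ∑ p', c p * c p' *
          ((P.card : ℝ) * ∑ j ∈ Fintype.piFinset fun _ : ι => P, d (j p) * d (j p')) := by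
        simp only [pow_two, Finset.sum_mul_sum]
        rw [Finset.sum_comm, Finset.mul_sum]
        refine Finset.sum_congr rfl fun p _ => ?_
        rw [Finset.sum_comm, Finset.mul_sum]
        refine Finset.sum_congr rfl fun p' _ => ?_
        simp only [Finset.mul_sum]
        exact Finset.sum_congr rfl fun j _ => by ring
    _ = ∑ p, c p * c p *
          ((P.card : ℝ) * ∑ j ∈ Fintype.piFinset fun _ : ι => P, d (j p) * d (j p)) := by
        refine Finset.sum_congr rfl fun p _ => Finset.sum_eq_single p (fun p' _ hp' => ?_) (by simp)
        rw [hoff p p' hp'.symm]; ring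
    _ = _ := by
        simp only [hdiag]
        rw [← Finset.sum_mul]
        simp only [← pow_two]
        ring

/-- Chebyshev's inequality for a weighted sum of independent uniform picks. -/
theorem card_filter_piFinset_le {P : Finset ℕ} (hP : P.Nonempty) (c : ι → ℝ) (e : ℕ → ℝ)
    {ε : ℝ} (hε : 0 < ε) :
    (((Fintype.piFinset fun _ : ι => P).filter fun j =>
        ε ≤ |∑ p, c p * e (j p) - (∑ p, c p) * ((1 / (P.card : ℝ)) * ∑ j ∈ P, e j)|).card : ℝ)
      ≤ (P.card : ℝ) ^ Fintype.card ι *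
        ((∑ p, c p ^ 2) * ((1 / (P.card : ℝ)) * ∑ j ∈ P, e j ^ 2) / ε ^ 2) := by
  have hP0 : (0 : ℝ) < P.card := by exact_mod_cast hP.card_pos
  have hvar := sum_piFinset_sq P c
  have hcard : (P.card : ℝ) * (1 / (P.card : ℝ)) = 1 := mul_one_div_cancel (Nat.cast_ne_zero.2 hP.card_pos.ne')
  obtain ⟨N, hN⟩ : ∃ N : ℝ, N = P.card := ⟨_, rfl⟩
  have hsN : ∀ t : ℝ, ∑ _j ∈ P, t = N * t := fun t => by rw [hN]; simp
  rw [← hN] at hP0 hcard hvar ⊢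
  clear hN
  obtain ⟨eb, heb⟩ : ∃ eb, eb = (1 / N) * ∑ j ∈ P, e j := ⟨_, rfl⟩
  have hsum : ∑ j ∈ P, e j = N * eb := by
    rw [heb, ← mul_assoc, hcard, one_mul]
  rw [← heb]
  set d : ℕ → ℝ := fun j => e j - eb with hd
  have hd0 : ∑ j ∈ P, d j = 0 := by
    simp only [hd, Finset.sum_sub_distrib, hsum, hsN, sub_self]
  have hd2 : ∑ j ∈ P, d j ^ 2 ≤ ∑ j ∈ P, e j ^ 2 := by
    have : ∑ j ∈ P, d j ^ 2 = ∑ j ∈ P, e j ^ 2 - N * eb ^ 2 := by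
      simp only [hd, sub_sq, Finset.sum_add_distrib, Finset.sum_sub_distrib, hsN, ← Finset.sum_mul, ← Finset.mul_sum, hsum]
      ring
    rw [this]
    have : 0 ≤ N * eb ^ 2 := by positivity
    linarith
  have hc : ∀ j : ι → ℕ, ∑ p, c p * e (j p) - (∑ p, c p) * eb = ∑ p, c p * d (j p) := by
    intro j
    simp only [hd, mul_sub, Finset.sum_sub_distrib, Finset.sum_mul]
  simp only [hc]
  have hvar := hvar d hd0
  set A := Fintype.piFinset fun _ : ι => P
  have h1 : ((A.filter fun j => ε ≤ |∑ p, c p * d (j p)|).card : ℝ) * ε ^ 2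
      ≤ ∑ j ∈ A, (∑ p, c p * d (j p)) ^ 2 := by
    calc _ = ∑ j ∈ A.filter (fun j => ε ≤ |∑ p, c p * d (j p)|), ε ^ 2 := by simp
      _ ≤ ∑ j ∈ A.filter (fun j => ε ≤ |∑ p, c p * d (j p)|), (∑ p, c p * d (j p)) ^ 2 := by
          refine Finset.sum_le_sum fun j hj => ?_
          rw [← sq_abs (∑ p, c p * d (j p))]
          exact pow_le_pow_left₀ hε.le (Finset.mem_filter.1 hj).2 2
      _ ≤ _ := Finset.sum_le_sum_of_subset_of_nonneg (Finset.filter_subset _ _)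
          fun _ _ _ => sq_nonneg _
  have h2 : ∑ j ∈ A, (∑ p, c p * d (j p)) ^ 2 = N ^ Fintype.card ι *
      ((∑ p, c p ^ 2) * ((1 / N) * ∑ j ∈ P, d j ^ 2)) := by
    rw [← mul_right_inj' hP0.ne', hvar]
    field_simp
  have hs : 0 ≤ ∑ p, c p ^ 2 := Finset.sum_nonneg fun _ _ => sq_nonneg _
  rw [← mul_div_assoc, le_div_iff₀ (by positivity)]
  refine h1.trans (h2.le.trans ?_)
  gcongr

end UniformPicks

/-! ### Concentration of the resampled residuals given the data. -/

namespace CausalModel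

variable {Ω 𝒵 : Type*} [MeasurableSpace Ω] [MeasurableSpace 𝒵] {n : ℕ}
  {M : CausalModel Ω 𝒵 n} {μ : Measure Ω} {i : Fin n}

theorem Valid.dataAlgebra_le (hM : M.Valid μ i) (S : Finset ℕ) :
    M.dataAlgebra S ≤ ‹MeasurableSpace Ω› :=
  iSup₂_le fun m _ => (hM.measurable_obs m).comap_le

/-- A bound for the probability of an event that depends on the data and on the picks. -/
theorem IsResampling.measure_le (hM : M.Valid μ i) [IsProbabilityMeasure μ] {S I : Finset ℕ}
    {R : ℕ} {J : ℕ → ℕ → Ω → ℕ} (hJ : M.IsResampling μ i S I R J) {E : Set Ω} {P : Finset ℕ}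
    (hE : MeasurableSet[M.dataAlgebra S] E) (hP : P.Nonempty) (hEP : ∀ ω ∈ E, M.pool i I ω = P)
    {B : (↥(I ×ˢ Finset.range R) → ℕ) → Set Ω}
    (hB : ∀ j ∈ Fintype.piFinset fun _ => P, MeasurableSet[M.dataAlgebra S] (B j))
    [∀ ω, DecidablePred fun j => ω ∈ B j] {κ : ℝ} (hκ : ∀ ω ∈ E,
      (((Fintype.piFinset fun _ => P).filter fun j => ω ∈ B j).card : ℝ)
        ≤ (P.card : ℝ) ^ (I ×ˢ Finset.range R).card * κ) :
    μ (E ∩ {ω | ω ∈ B fun p => J p.1.1 p.1.2 ω}) ≤ ENNReal.ofReal κ * μ E := by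
  have hle := hM.dataAlgebra_le S
  set A := Fintype.piFinset fun _ : ↥(I ×ˢ Finset.range R) => P with hA
  set G : (↥(I ×ˢ Finset.range R) → ℕ) → Set Ω := fun j => {ω | ∀ p : ↥(I ×ˢ Finset.range R), J p.1.1 p.1.2 ω = j p} with hG
  have hGm : ∀ j, MeasurableSet (G j) := fun j => by
    simp only [hG, Set.ofPred_forall]
    exact MeasurableSet.iInter fun p => hJ.measurable _ _ (measurableSet_singleton (j p))
  have hG' : ∀ E' : Set Ω, MeasurableSet[M.dataAlgebra S] E' → (∀ ω ∈ E', M.pool i I ω = P) →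
      ∀ j ∈ A, μ (E' ∩ G j) = μ E' * ((P.card : ℝ≥0∞)⁻¹) ^ (I ×ˢ Finset.range R).card := by
    intro E' hE' hEP' j hj
    -- The value `0` off the index set is never used.
    have h := hJ.uniform E' P hE' hP hEP' (I ×ˢ Finset.range R) (fun p => if h : p ∈ I ×ˢ Finset.range R then j ⟨p, h⟩ else 0)
      le_rfl fun p hp => by
        simpa only [hp, dif_pos] using Fintype.mem_piFinset.1 hj ⟨p, hp⟩
    rw [← h]
    congr 2
    ext ω
    simp only [hG, Set.mem_ofPred_eq, Subtype.forall]
    refine forall₂_congr fun p hp => ?_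
    simp [hp]
  have hcard : (A.card : ℝ≥0∞) * ((P.card : ℝ≥0∞)⁻¹) ^ (I ×ˢ Finset.range R).card = 1 := by
    rw [hA, Fintype.card_piFinset]
    simp only [Finset.prod_const, Finset.card_univ, Fintype.card_coe, Nat.cast_pow]
    rw [← mul_pow, ENNReal.mul_inv_cancel (by simpa using hP.card_pos.ne') (by simp), one_pow]
  have hdisj : (A : Set (↥(I ×ˢ Finset.range R) → ℕ)).PairwiseDisjoint fun j => E ∩ G j := by
    intro j _ j' _ hjj
    refine Set.disjoint_left.2 fun ω h1 h2 => hjj (funext fun p => ?_)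
    rw [← h1.2 p, ← h2.2 p]
  -- `IsResampling.uniform` speaks only of picks in `P`. That almost surely no other picks occur
  -- follows because the probabilities of the disjoint events `E ∩ G j` already add up to `μ E`.
  have hcover : μ (E \ ⋃ j ∈ A, E ∩ G j) = 0 := by
    have hU : MeasurableSet (⋃ j ∈ A, E ∩ G j) :=
      Finset.measurableSet_biUnion A fun j _ => (hle _ hE).inter (hGm j)
    rw [measure_sdiff (Set.iUnion₂_subset fun j _ => Set.inter_subset_left) hU.nullMeasurableSet
      (measure_ne_top μ _), measure_biUnion_finset hdisj fun j _ => (hle _ hE).inter (hGm j),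
      Finset.sum_congr rfl fun j hj => hG' E hE hEP j hj, Finset.sum_const, nsmul_eq_mul,
      mul_left_comm, hcard, mul_one, tsub_self]
  calc μ (E ∩ {ω | ω ∈ B fun p => J p.1.1 p.1.2 ω})
      ≤ μ ((E \ ⋃ j ∈ A, E ∩ G j) ∪ ⋃ j ∈ A, (E ∩ B j) ∩ G j) := by
        refine measure_mono fun ω hω => ?_
        by_cases h : ω ∈ ⋃ j ∈ A, E ∩ G j
        · right
          simp only [Set.mem_iUnion] at h ⊢
          obtain ⟨j, hj, h1, h2⟩ := h
          refine ⟨j, hj, ⟨h1, ?_⟩, h2⟩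
          have : (fun p : ↥(I ×ˢ Finset.range R) => J p.1.1 p.1.2 ω) = j := funext h2
          rw [← this]; exact hω.2
        · exact Or.inl ⟨hω.1, h⟩
    _ ≤ 0 + ∑ j ∈ A, μ ((E ∩ B j) ∩ G j) :=
        (measure_union_le _ _).trans (add_le_add hcover.le (measure_biUnion_finset_le _ _))
    _ = ((P.card : ℝ≥0∞)⁻¹) ^ (I ×ˢ Finset.range R).card * ∑ j ∈ A, μ (E ∩ B j) := by
        rw [zero_add, Finset.mul_sum]
        refine Finset.sum_congr rfl fun j hj => ?_
        -- `E ∩ B j` is again a data event on which the pool is `P`, so uniformity applies to it: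
        -- this is the independence of picks and data.
        rw [hG' (E ∩ B j) (MeasurableSet.inter hE (hB j hj)) (fun ω hω => hEP ω hω.1) j hj, mul_comm]
    _ = ((P.card : ℝ≥0∞)⁻¹) ^ (I ×ˢ Finset.range R).card *
          ∫⁻ ω in E, ∑ j ∈ A, (B j).indicator (fun _ => (1 : ℝ≥0∞)) ω ∂μ := by
        rw [lintegral_finsetSum' _ fun j hj =>
          (measurable_const.indicator (hle _ (hB j hj))).aemeasurable]
        congr 1
        refine Finset.sum_congr rfl fun j hj => ?_
        rw [lintegral_indicator_const (hle _ (hB j hj)), one_mul,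
          Measure.restrict_apply (hle _ (hB j hj)), Set.inter_comm]
    _ ≤ ((P.card : ℝ≥0∞)⁻¹) ^ (I ×ˢ Finset.range R).card *
          ∫⁻ _ in E, (P.card : ℝ≥0∞) ^ (I ×ˢ Finset.range R).card * ENNReal.ofReal κ ∂μ := by
        refine mul_le_mul' le_rfl (setLIntegral_mono measurable_const fun ω hω => ?_)
        have h1 : ∑ j ∈ A, (B j).indicator (fun _ => (1 : ℝ≥0∞)) ω
            = ((A.filter fun j => ω ∈ B j).card : ℝ≥0∞) := by
          simp [Set.indicator_apply]
        rw [h1, ← ENNReal.ofReal_natCast, ← ENNReal.ofReal_natCast P.card,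
          ← ENNReal.ofReal_pow (by positivity), ← ENNReal.ofReal_mul (by positivity)]
        exact ENNReal.ofReal_le_ofReal (hκ ω hω)
    _ = ENNReal.ofReal κ * μ E := by
        rw [setLIntegral_const, ← mul_assoc, ← mul_assoc, ← mul_pow,
          ENNReal.inv_mul_cancel (by simpa using hP.card_pos.ne') (by simp), one_pow, one_mul]

/-- The resampled residual term concentrates around the product of the averages of the weights
and of the residuals. -/
theorem IsResampling.measure_abs_sub_ge_le (hM : M.Valid μ i) [IsProbabilityMeasure μ]
    {S I : Finset ℕ} {R : ℕ} (hR : 1 ≤ R) {J : ℕ → ℕ → Ω → ℕ} (hJ : M.IsResampling μ i S I R J)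
    (hIS : I ⊆ S) {e w : ℕ → Ω → ℝ} (he : ∀ m ∈ I, Measurable[M.dataAlgebra S] (e m))
    (hw : ∀ m ∈ I, Measurable[M.dataAlgebra S] (w m)) {ε K : ℝ} (hε : 0 < ε) :
    μ {ω | (M.pool i I ω).Nonempty ∧
        ((1 / (I.card : ℝ)) * ∑ m ∈ I, w m ω ^ 2) *
          ((1 / ((M.pool i I ω).card : ℝ)) * ∑ j ∈ M.pool i I ω, e j ω ^ 2) ≤ K ∧
        ε ≤ |(1 / (R : ℝ)) * ∑ u ∈ Finset.range R, ((1 / (I.card : ℝ)) *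
            ∑ m ∈ M.poolCompl i I ω, e (J m u ω) ω * w m ω)
          - ((1 / (I.card : ℝ)) * ∑ m ∈ M.poolCompl i I ω, w m ω) *
            ((1 / ((M.pool i I ω).card : ℝ)) * ∑ j ∈ M.pool i I ω, e j ω)|}
      ≤ ENNReal.ofReal ((1 / (I.card : ℝ)) * K / ε ^ 2) := by
  classical
  have hle := hM.dataAlgebra_le S
  have hD : ∀ m ∈ I, MeasurableSet[M.dataAlgebra S] {ω | M.D m ω = i} := by
    intro m hm
    have h1 : MeasurableSet[MeasurableSpace.comap (M.obs m) inferInstance] {ω | M.D m ω = i} :=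
      ⟨{o | o.2.1 = i}, (measurable_fst.comp measurable_snd) (measurableSet_singleton i), rfl⟩
    exact (le_iSup₂ (f := fun m _ => MeasurableSpace.comap (M.obs m) inferInstance) m (hIS hm)) _ h1
  have hpool : ∀ P : Finset ℕ, MeasurableSet[M.dataAlgebra S] {ω | M.pool i I ω = P} := by
    intro P
    by_cases hPI : P ⊆ I
    · have : {ω | M.pool i I ω = P} = ⋂ m ∈ I, {ω | M.D m ω = i ↔ m ∈ P} := by
        ext ω
        simp only [pool, Finset.ext_iff, Finset.mem_filter, Set.mem_iInter, Set.mem_ofPred_eq]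
        exact ⟨fun h m hm => by simp [← h m, hm], fun h m =>
          ⟨fun h' => (h m h'.1).1 h'.2, fun h' => ⟨hPI h', (h m (hPI h')).2 h'⟩⟩⟩
      rw [this]
      refine Finset.measurableSet_biInter I fun m hm => ?_
      by_cases hmP : m ∈ P
      · simpa [hmP] using hD m hm
      · simp only [hmP, iff_false]
        exact (hD m hm).compl
    · have : {ω | M.pool i I ω = P} = ∅ := by
        ext ω
        simp only [Set.mem_ofPred_eq, Set.mem_empty_iff_false, iff_false]
        rintro rfl
        exact hPI (Finset.filter_subset _ _)
      rw [this]
      exact @MeasurableSet.empty _ (M.dataAlgebra S)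
  set κ := (1 / (I.card : ℝ)) * K / ε ^ 2 with hκ
  set Q : Finset ℕ → Ω → ℝ := fun P ω => ((1 / (I.card : ℝ)) * ∑ m ∈ I, w m ω ^ 2) *
          ((1 / (P.card : ℝ)) * ∑ j ∈ P, e j ω ^ 2) with hQ
  -- The event is split according to the value `P` of the pool; on each piece, the random index sets
  -- become fixed.
  set E : Finset ℕ → Set Ω := fun P => {ω | M.pool i I ω = P} ∩ {ω | Q P ω ≤ K} with hEdef
  -- Setting the weights of treated individuals to zero lets the sum run over all of `I ×ˢ range R`.
  set c : Finset ℕ → ↥(I ×ˢ Finset.range R) → Ω → ℝ := fun P p ω =>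
    (1 / (R : ℝ)) * (1 / (I.card : ℝ)) * (if p.1.1 ∈ P then 0 else w p.1.1 ω) with hc
  set B : Finset ℕ → (↥(I ×ˢ Finset.range R) → ℕ) → Set Ω := fun P j =>
    {ω | ε ≤ |∑ p, c P p ω * e (j p) ω
      - (∑ p, c P p ω) * ((1 / (P.card : ℝ)) * ∑ j ∈ P, e j ω)|} with hBdef
  set U := I.powerset.filter fun P => P.Nonempty with hU
  have hEm : ∀ P ∈ U, MeasurableSet[M.dataAlgebra S] (E P) := by
    intro P hP
    have hPI : P ⊆ I := Finset.mem_powerset.1 (Finset.mem_filter.1 hP).1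
    refine MeasurableSet.inter (hpool P) ?_
    refine measurableSet_le (mδ := M.dataAlgebra S) ?_ measurable_const
    refine Measurable.mul (Measurable.const_mul ?_ _) (Measurable.const_mul ?_ _)
    · exact Finset.measurable_sum _ fun m hm => (hw m hm).pow_const 2
    · exact Finset.measurable_sum _ fun m hm => (he m (hPI hm)).pow_const 2
  have hcm : ∀ P p, Measurable[M.dataAlgebra S] (c P p) := by
    intro P p
    refine Measurable.const_mul ?_ _
    by_cases hp : p.1.1 ∈ P
    · simpa only [hp, if_true] using measurable_const
    · simpa only [hp, if_false] using hw _ (Finset.mem_product.1 p.2).1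
  have hBm : ∀ P ∈ U, ∀ j ∈ Fintype.piFinset fun _ => P,
      MeasurableSet[M.dataAlgebra S] (B P j) := by
    intro P hP j hj
    have hPI : P ⊆ I := Finset.mem_powerset.1 (Finset.mem_filter.1 hP).1
    refine measurableSet_le (mδ := M.dataAlgebra S) measurable_const ?_
    refine measurable_norm.comp (?_ : Measurable[M.dataAlgebra S] fun ω =>
      ∑ p, c P p ω * e (j p) ω - (∑ p, c P p ω) * ((1 / (P.card : ℝ)) * ∑ j ∈ P, e j ω))
    refine Measurable.sub ?_ (Measurable.mul ?_ (Measurable.const_mul ?_ _))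
    · exact Finset.measurable_sum _ fun p _ =>
        (hcm P p).mul (he _ (hPI (Fintype.mem_piFinset.1 hj p)))
    · exact Finset.measurable_sum _ fun p _ => hcm P p
    · exact Finset.measurable_sum _ fun m hm => he m (hPI hm)
  have hR0 : (0 : ℝ) < R := by exact_mod_cast hR
  have hcsum : ∀ P ω, M.pool i I ω = P → ∀ f : ℕ → ℕ → ℝ,
      ∑ p, c P p ω * f p.1.1 p.1.2 = (1 / (R : ℝ)) * ∑ u ∈ Finset.range R,
        ((1 / (I.card : ℝ)) * ∑ m ∈ M.poolCompl i I ω, f m u * w m ω) := by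
    intro P ω hP f
    rw [Finset.sum_coe_sort (I ×ˢ Finset.range R) fun p => (1 / (R : ℝ)) * (1 / (I.card : ℝ)) *
      (if p.1 ∈ P then 0 else w p.1 ω) * f p.1 p.2, Finset.sum_product_right, Finset.mul_sum]
    refine Finset.sum_congr rfl fun u _ => ?_
    rw [poolCompl, Finset.sum_filter, ← mul_assoc, Finset.mul_sum]
    refine Finset.sum_congr rfl fun m hm => ?_
    rw [← hP]
    by_cases hDm : M.D m ω = i
    · simp [pool, hDm, hm]
    · simp [pool, hDm]
      ring
  have hc2 : ∀ P ω, ∑ p, c P p ω ^ 2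
      ≤ (1 / (I.card : ℝ)) * ((1 / (I.card : ℝ)) * ∑ m ∈ I, w m ω ^ 2) := by
    intro P ω
    rw [Finset.sum_coe_sort (I ×ˢ Finset.range R) fun p => ((1 / (R : ℝ)) * (1 / (I.card : ℝ)) *
      (if p.1 ∈ P then 0 else w p.1 ω)) ^ 2, Finset.sum_product_right]
    calc _ ≤ ∑ u ∈ Finset.range R, ∑ m ∈ I, ((1 / (R : ℝ)) * (1 / (I.card : ℝ)) * w m ω) ^ 2 := by
          refine Finset.sum_le_sum fun u _ => Finset.sum_le_sum fun m _ => ?_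
          dsimp only
          split_ifs
          · rw [mul_zero, zero_pow two_ne_zero]; exact sq_nonneg _
          · exact le_rfl
      _ = (1 / (R : ℝ)) * ((1 / (I.card : ℝ)) * ((1 / (I.card : ℝ)) * ∑ m ∈ I, w m ω ^ 2)) := by
          simp only [mul_pow, ← Finset.mul_sum, Finset.sum_const, Finset.card_range, nsmul_eq_mul]
          field_simp
      -- More rounds only decrease the variance; dropping the factor `1 / R` makes the bound uniform
      -- in `R`.
      _ ≤ _ := by
          refine mul_le_of_le_one_left ?_ ?_
          · have : 0 ≤ ∑ m ∈ I, w m ω ^ 2 := Finset.sum_nonneg fun _ _ => sq_nonneg _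
            positivity
          · rw [div_le_one hR0]; exact_mod_cast hR
  have hkey : ∀ P ∈ U, μ (E P ∩ {ω | ω ∈ B P fun p => J p.1.1 p.1.2 ω})
      ≤ ENNReal.ofReal κ * μ (E P) := by
    intro P hP
    have hPne : P.Nonempty := (Finset.mem_filter.1 hP).2
    refine hJ.measure_le hM (hEm P hP) hPne (fun ω hω => hω.1) (hBm P hP) ?_
    intro ω hω
    have h := card_filter_piFinset_le (ι := ↥(I ×ˢ Finset.range R)) hPne (fun p => c P p ω)
      (fun j => e j ω) hε
    rw [Fintype.card_coe] at h
    have hs : 0 ≤ ∑ j ∈ P, e j ω ^ 2 := Finset.sum_nonneg fun _ _ => sq_nonneg _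
    refine le_trans (le_of_eq ?_) (h.trans ?_)
    · congr!
    · rw [hκ]
      refine mul_le_mul_of_nonneg_left (div_le_div_of_nonneg_right ?_ (sq_nonneg ε))
        (pow_nonneg (Nat.cast_nonneg _) _)
      calc _ ≤ (1 / (I.card : ℝ)) * ((1 / (I.card : ℝ)) * ∑ m ∈ I, w m ω ^ 2) *
            ((1 / (P.card : ℝ)) * ∑ j ∈ P, e j ω ^ 2) := by
            gcongr
            exact hc2 P ω
        _ = (1 / (I.card : ℝ)) * Q P ω := by rw [hQ]; ring
        _ ≤ _ := by gcongr; exact hω.2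
  have hdisj : (U : Set (Finset ℕ)).PairwiseDisjoint E := by
    intro P _ P' _ hPP
    exact Set.disjoint_left.2 fun ω h1 h2 => hPP (h1.1.symm.trans h2.1)
  calc _ ≤ μ (⋃ P ∈ U, E P ∩ {ω | ω ∈ B P fun p => J p.1.1 p.1.2 ω}) := by
        refine measure_mono fun ω hω => ?_
        obtain ⟨h1, h2, h3⟩ := hω
        refine Set.mem_biUnion (x := M.pool i I ω) ?_ ⟨⟨rfl, h2⟩, ?_⟩
        · simp only [hU, Finset.coe_filter, Finset.mem_powerset, Set.mem_ofPred_eq]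
          exact ⟨Finset.filter_subset _ _, h1⟩
        · simp only [hBdef, Set.mem_ofPred_eq]
          have e1 := hcsum _ ω rfl fun m u => e (J m u ω) ω
          have e2 := hcsum _ ω rfl fun _ _ => 1
          simp only [mul_one, one_mul, Finset.sum_const, Finset.card_range, nsmul_eq_mul] at e2
          rw [← mul_assoc, one_div_mul_cancel hR0.ne', one_mul] at e2
          rw [e1, e2]
          exact h3
    _ ≤ ∑ P ∈ U, ENNReal.ofReal κ * μ (E P) :=
        (measure_biUnion_finset_le _ _).trans (Finset.sum_le_sum hkey)
    _ = ENNReal.ofReal κ * μ (⋃ P ∈ U, E P) := by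
        rw [measure_biUnion_finset hdisj fun P hP => hle _ (hEm P hP), Finset.mul_sum]
    _ ≤ ENNReal.ofReal κ * 1 := by gcongr; exact prob_le_one
    _ = _ := mul_one _

end CausalModel

/-! ### Continuity of the coefficients in the moments. -/

section Algebra

variable {Ω ι : Type*} [MeasurableSpace Ω] {μ : Measure Ω} {l : Filter ι} {f g : ι → Ω → ℝ}
  {c d : ℝ}

theorem MeasureTheory.TendstoInMeasure.mul_const_limits (hf : TendstoInMeasure μ f l fun _ => c)
    (hg : TendstoInMeasure μ g l fun _ => d) :
    TendstoInMeasure μ (fun n ω => f n ω * g n ω) l fun _ => c * d :=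
  (hf.prodMk_const hg).comp_continuousAt (h := fun p : ℝ × ℝ => p.1 * p.2) (by fun_prop)

theorem MeasureTheory.TendstoInMeasure.sub_const_limits (hf : TendstoInMeasure μ f l fun _ => c)
    (hg : TendstoInMeasure μ g l fun _ => d) :
    TendstoInMeasure μ (fun n ω => f n ω - g n ω) l fun _ => c - d :=
  (hf.prodMk_const hg).comp_continuousAt (h := fun p : ℝ × ℝ => p.1 - p.2) (by fun_prop)

theorem MeasureTheory.TendstoInMeasure.neg_const_limit (hf : TendstoInMeasure μ f l fun _ => c) :
    TendstoInMeasure μ (fun n ω => -f n ω) l fun _ => -c :=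
  hf.comp_continuousAt (h := fun p : ℝ => -p) (by fun_prop)

theorem MeasureTheory.TendstoInMeasure.inv_const_limit (hf : TendstoInMeasure μ f l fun _ => c)
    (hc : c ≠ 0) : TendstoInMeasure μ (fun n ω => (f n ω)⁻¹) l fun _ => c⁻¹ :=
  hf.comp_continuousAt (h := fun p : ℝ => p⁻¹) (continuousAt_inv₀ hc)

theorem tendstoInMeasure_finset_sum {κ : Type*} {s : Finset κ} {f : κ → ι → Ω → ℝ} {c : κ → ℝ}
    (hf : ∀ j ∈ s, TendstoInMeasure μ (f j) l fun _ => c j) :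
    TendstoInMeasure μ (fun n ω => ∑ j ∈ s, f j n ω) l fun _ => ∑ j ∈ s, c j := by
  classical
  induction s using Finset.induction_on with
  | empty => simpa using tendstoInMeasure_const (0 : ℝ)
  | insert a s ha ih =>
    simp only [Finset.sum_insert ha]
    exact (hf a (Finset.mem_insert_self a s)).add_const_limits
      (ih fun j hj => hf j (Finset.mem_insert_of_mem hj))

/-- The recursion expresses `coeffB` rationally in the moments of order at most `r`, with `mom r` as
the only denominator. The induction follows the termination measure `k - 1 - q`. -/
theorem tendstoInMeasure_coeffB {mom : ι → Ω → ℕ → ℝ} {mom₀ : ℕ → ℝ} {r k : ℕ} (hkr : k ≤ r)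
    (h0 : mom₀ r ≠ 0)
    (hmom : ∀ q ≤ r, TendstoInMeasure μ (fun n ω => mom n ω q) l fun _ => mom₀ q) (q : ℕ) :
    TendstoInMeasure μ (fun n ω => coeffB (mom n ω) r k q) l fun _ => coeffB mom₀ r k q := by
  induction hs : k - 1 - q using Nat.strong_induction_on generalizing q with
  | _ s ih =>
    simp only [fun mom : ℕ → ℝ => coeffB.eq_1 mom r k q]
    refine TendstoInMeasure.sub_const_limits (TendstoInMeasure.neg_const_limit
      (tendstoInMeasure_finset_sum fun u _ => ?_)) ?_
    · have hu := u.isLt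
      exact ((ih _ (by omega) _ rfl).mul_const_limits (tendstoInMeasure_const _)).mul_const_limits
        (hmom _ (by omega))
    · exact (((hmom r le_rfl).inv_const_limit h0).mul_const_limits
        (tendstoInMeasure_const _)).mul_const_limits (hmom _ (Nat.sub_le _ _))

end Algebra

/-! ### Vanishing of the residual parts, and consistency. -/

namespace CausalModel

variable {Ω 𝒵 : Type*} [MeasurableSpace Ω] [MeasurableSpace 𝒵] {n : ℕ}
  {M : CausalModel Ω 𝒵 n} {μ : Measure Ω} {i : Fin n} {r k : ℕ}

omit [MeasurableSpace Ω] in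
theorem measurable_obs_dataAlgebra {S : Finset ℕ} {m : ℕ} (hm : m ∈ S) :
    Measurable[M.dataAlgebra S] (M.obs m) :=
  (comap_measurable (M.obs m)).mono
    (le_iSup₂ (f := fun m _ => MeasurableSpace.comap (M.obs m) inferInstance) m hm) le_rfl

omit [MeasurableSpace Ω] in
theorem measurable_trained_dataAlgebra {S Ic : Finset ℕ} (hIc : Ic ⊆ S) {m : ℕ} (hm : m ∈ S)
    {T : (Ic → ℝ × Fin n × 𝒵) → 𝒵 → ℝ} (hT : Measurable (Function.uncurry T)) :
    Measurable[M.dataAlgebra S] fun ω => M.trained T ω (M.Z m ω) := by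
  have h1 : Measurable[M.dataAlgebra S] fun ω (s : Ic) => M.obs s ω :=
    @measurable_pi_lambda Ω Ic (fun _ => ℝ × Fin n × 𝒵) (M.dataAlgebra S) _ _
      fun s => measurable_obs_dataAlgebra (hIc s.2)
  have h2 : Measurable[M.dataAlgebra S] fun ω => (M.obs m ω).2.2 :=
    (measurable_snd.comp measurable_snd).comp (measurable_obs_dataAlgebra hm)
  exact hT.comp (h1.prodMk h2)

omit [MeasurableSpace Ω] in
theorem measurable_treated_dataAlgebra {S : Finset ℕ} {m : ℕ} (hm : m ∈ S) :
    Measurable[M.dataAlgebra S] (M.treated i m) := by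
  have h : Measurable fun o : ℝ × Fin n × 𝒵 => if o.2.1 = i then (1 : ℝ) else 0 :=
    Measurable.ite ((measurable_fst.comp measurable_snd) (measurableSet_singleton i))
      measurable_const measurable_const
  exact h.comp (measurable_obs_dataAlgebra hm)

omit [MeasurableSpace Ω] [MeasurableSpace 𝒵] in
theorem sum_pool (I : Finset ℕ) (ω : Ω) (f : ℕ → ℝ) :
    ∑ m ∈ M.pool i I ω, f m = ∑ m ∈ I, M.treated i m ω * f m := by
  simp [pool, Finset.sum_filter, treated]

omit [MeasurableSpace Ω] [MeasurableSpace 𝒵] in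
theorem sum_poolCompl (I : Finset ℕ) (ω : Ω) (f : ℕ → ℝ) :
    ∑ m ∈ M.poolCompl i I ω, f m = ∑ m ∈ I, (1 - M.treated i m ω) * f m := by
  rw [poolCompl, Finset.sum_filter]
  refine Finset.sum_congr rfl fun m _ => ?_
  by_cases h : M.D m ω = i <;> simp [treated, h]

-- A mean over the random pool becomes a ratio of two averages over `I`, to which the weak law
-- applies. For an empty pool both sides are zero.
omit [MeasurableSpace Ω] [MeasurableSpace 𝒵] in
theorem average_pool_eq (I : Finset ℕ) (ω : Ω) (f : ℕ → ℝ) :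
    (1 / ((M.pool i I ω).card : ℝ)) * ∑ m ∈ M.pool i I ω, f m
      = ((1 / (I.card : ℝ)) * ∑ m ∈ I, M.treated i m ω * f m)
        * ((1 / (I.card : ℝ)) * ∑ m ∈ I, M.treated i m ω)⁻¹ := by
  have hc : ((M.pool i I ω).card : ℝ) = ∑ m ∈ I, M.treated i m ω := by
    rw [Finset.card_eq_sum_ones]
    push_cast
    simpa using sum_pool (M := M) (i := i) I ω fun _ => 1
  rw [hc, sum_pool]
  rcases I.eq_empty_or_nonempty with rfl | hI
  · simp
  · have hI0 : (I.card : ℝ) ≠ 0 := by exact_mod_cast hI.card_pos.ne'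
    rw [mul_inv, one_div, one_div, inv_inv]
    field_simp

variable {I Ic : ℕ → Finset ℕ} {gTrain πTrain : (N : ℕ) → (Ic N → ℝ × Fin n × 𝒵) → 𝒵 → ℝ}
  {𝒯 : Set ((𝒵 → ℝ) × (𝒵 → ℝ))} [IsProbabilityMeasure μ]

/-- The resampled residuals contribute nothing in the limit. -/
theorem TrainedNuisance.tendsto_resampled (T : M.TrainedNuisance μ i r k I Ic gTrain πTrain 𝒯)
    {R : ℕ → ℕ} (hR : ∀ N, 1 ≤ R N) {J : ℕ → ℕ → ℕ → Ω → ℕ}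
    (hJ : ∀ N, M.IsResampling μ i (I N ∪ Ic N) (I N) (R N) (J N)) {q : ℕ} (hq : q ≤ r) :
    TendstoInMeasure μ (fun (N : ℕ) ω => (1 / (R N : ℝ)) * ∑ u ∈ Finset.range (R N),
      ((1 / (N : ℝ)) * ∑ m ∈ M.poolCompl i (I N) ω,
        (M.observed (J N m u ω) ω - M.trained (gTrain N) ω (M.Z (J N m u ω) ω))
          * (M.treated i m ω - M.trained (πTrain N) ω (M.Z m ω)) ^ q)) atTop fun _ => 0 := by
  have hM := T.valid
  set e : ℕ → ℕ → Ω → ℝ := fun N m ω =>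
    M.observed m ω - M.trained (gTrain N) ω (M.Z m ω) with he
  set w : ℕ → ℕ → Ω → ℝ := fun N m ω =>
    (M.treated i m ω - M.trained (πTrain N) ω (M.Z m ω)) ^ q with hw
  have hp : 0 < ∫ ω, M.treated i 0 ω ∂μ :=
    hM.integral_treated_pos (by have := T.two_le; have := T.le; omega) T.moment_ne
  set p := ∫ ω, M.treated i 0 ω ∂μ
  have hT := T.tendsto_average_treated
  have hT' := hT.inv_const_limit hp.ne'
  have hW := T.tendsto_average_untreated_pow hq
  have hA := T.tendsto_average_residual (Nat.zero_le r)
  simp only [pow_zero, mul_one] at hA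
  have hE : TendstoInMeasure μ (fun (N : ℕ) ω => ((1 / (N : ℝ)) *
      ∑ m ∈ M.poolCompl i (I N) ω, w N m ω) * ((1 / ((M.pool i (I N) ω).card : ℝ)) *
        ∑ j ∈ M.pool i (I N) ω, e N j ω)) atTop fun _ => 0 := by
    have h := hW.mul_const_limits (hA.mul_const_limits hT')
    simp only [zero_mul, mul_zero] at h
    simpa only [average_pool_eq, sum_poolCompl, T.card] using h
  set K₀ := (∫ ω, (M.ν i 0 ω ^ q) ^ 2 ∂μ) * ((∫ ω, M.treated i 0 ω * M.ξF i 0 ω ^ 2 ∂μ) * p⁻¹)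
  have hQ : TendstoInMeasure μ (fun (N : ℕ) ω => ((1 / (N : ℝ)) *
      ∑ m ∈ I N, w N m ω ^ 2) * ((1 / ((M.pool i (I N) ω).card : ℝ)) *
        ∑ j ∈ M.pool i (I N) ω, e N j ω ^ 2)) atTop fun _ => K₀ := by
    have h := (T.tendsto_average_sq hq).mul_const_limits
      (T.tendsto_average_residual_sq.mul_const_limits hT')
    simpa only [average_pool_eq, T.card] using h
  rw [tendstoInMeasure_iff_norm] at hT hE hQ ⊢
  intro ε hε
  have hε2 : 0 < ε / 2 := half_pos hε
  have hlast : Tendsto (fun N : ℕ => ENNReal.ofReal ((1 / (N : ℝ)) * (K₀ + 1) / (ε / 2) ^ 2)) atTop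
      (𝓝 0) := by
    rw [← ENNReal.ofReal_zero]
    refine ENNReal.tendsto_ofReal ?_
    simpa using (tendsto_one_div_atTop_nhds_zero_nat.mul_const (K₀ + 1)).div_const ((ε / 2) ^ 2)
  -- Outside four events of vanishing probability the resampled term is small. In these events,
  -- respectively, the proportion of treated is off by at least `p`, the variance factor is at least
  -- `1` away from `K₀`, the centre is at least `ε / 2` in size, or the picks deviate from the
  -- centre by `ε / 2`.
  have hlim := (((hT p hp).add (hQ 1 one_pos)).add (hE (ε / 2) hε2)).add hlast
  simp only [add_zero] at hlim
  refine tendsto_of_tendsto_of_tendsto_of_le_of_le tendsto_const_nhds hlim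
    (fun _ => zero_le) fun N => ?_
  have hIS : I N ⊆ I N ∪ Ic N := Finset.subset_union_left
  have hIcS : Ic N ⊆ I N ∪ Ic N := Finset.subset_union_right
  have hmain := (hJ N).measure_abs_sub_ge_le hM (hR N) hIS (e := e N) (w := w N)
    (fun m hm => Measurable.sub (measurable_fst.comp (measurable_obs_dataAlgebra (hIS hm)))
      (measurable_trained_dataAlgebra hIcS (hIS hm) (T.measurable_g N)))
    (fun m hm => Measurable.pow_const (Measurable.sub (measurable_treated_dataAlgebra (hIS hm))
      (measurable_trained_dataAlgebra hIcS (hIS hm) (T.measurable_π N))) q)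
    (K := K₀ + 1) hε2
  rw [T.card N] at hmain
  refine le_trans (measure_mono fun ω hω => ?_) ((measure_union_le _ _).trans
    (add_le_add ((measure_union_le _ _).trans (add_le_add (measure_union_le _ _) le_rfl)) hmain))
  by_contra hcon
  simp only [Set.mem_union, Set.mem_ofPred_eq, not_or, not_le] at hcon
  obtain ⟨⟨⟨c1, c2⟩, c3⟩, c4⟩ := hcon
  refine c4 ⟨?_, ?_, ?_⟩
  -- An empty pool makes the proportion of treated zero, at distance exactly `p` from its limit.
  · by_contra hne
    rw [Finset.not_nonempty_iff_eq_empty] at hne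
    have h0 := sum_pool (M := M) (i := i) (I N) ω fun _ => 1
    simp only [hne, Finset.sum_empty, mul_one] at h0
    rw [← h0, mul_zero, zero_sub, norm_neg, Real.norm_of_nonneg hp.le] at c1
    exact lt_irrefl _ c1
  · rw [Real.norm_eq_abs] at c2
    linarith [(abs_lt.1 c2).2]
  · rw [sub_zero, Real.norm_eq_abs] at c3
    have h1 : ε ≤ |(1 / (R N : ℝ)) * ∑ u ∈ Finset.range (R N), ((1 / (N : ℝ)) *
      ∑ m ∈ M.poolCompl i (I N) ω, e N (J N m u ω) ω * w N m ω)| := by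
      rw [Set.mem_ofPred_eq, sub_zero, Real.norm_eq_abs] at hω
      exact hω
    have h2 := abs_sub_abs_le_abs_sub ((1 / (R N : ℝ)) * ∑ u ∈ Finset.range (R N), ((1 / (N : ℝ)) *
      ∑ m ∈ M.poolCompl i (I N) ω, e N (J N m u ω) ω * w N m ω)) (((1 / (N : ℝ)) *
      ∑ m ∈ M.poolCompl i (I N) ω, w N m ω) * ((1 / ((M.pool i (I N) ω).card : ℝ)) *
        ∑ j ∈ M.pool i (I N) ω, e N j ω))
    linarith

/-- The part of the estimator in which the residuals, factual or resampled, are weighted by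
`f`. -/
noncomputable def residualPart (M : CausalModel Ω 𝒵 n) (i : Fin n) (I : Finset ℕ) (R : ℕ) (x : 𝒵 → ℝ)
    (J : ℕ → ℕ → Ω → ℕ) (ω : Ω) (f : ℕ → ℝ) : ℝ :=
  (1 / (I.card : ℝ)) * ∑ m ∈ M.pool i I ω, (M.observed m ω - x (M.Z m ω)) * f m
  + (1 / (R : ℝ)) * ∑ u ∈ Finset.range R,
      ((1 / (I.card : ℝ)) * ∑ m ∈ M.poolCompl i I ω,
        (M.observed (J m u ω) ω - x (M.Z (J m u ω) ω)) * f m)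

-- Linearity in the weights, with coefficients independent of them, is all that is needed to split
-- the weight `A` into powers.
omit [MeasurableSpace Ω] [MeasurableSpace 𝒵] in
theorem residualPart_eq (I : Finset ℕ) (R : ℕ) (x : 𝒵 → ℝ) (J : ℕ → ℕ → Ω → ℕ) (ω : Ω) :
    ∃ c : ℕ → ℝ, ∀ f : ℕ → ℝ, M.residualPart i I R x J ω f = ∑ m ∈ I, c m * f m := by
  refine ⟨fun m => (1 / (I.card : ℝ)) * (M.treated i m ω * (M.observed m ω - x (M.Z m ω)))
    + (1 / (R : ℝ)) * ∑ u ∈ Finset.range R, (1 / (I.card : ℝ)) * ((1 - M.treated i m ω) *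
      (M.observed (J m u ω) ω - x (M.Z (J m u ω) ω))), fun f => ?_⟩
  simp only [residualPart, sum_pool, sum_poolCompl, add_mul, Finset.sum_add_distrib]
  congr 1
  · rw [Finset.mul_sum]
    exact Finset.sum_congr rfl fun m _ => by ring
  · simp only [Finset.mul_sum, Finset.sum_mul]
    rw [Finset.sum_comm]
    exact Finset.sum_congr rfl fun m _ => Finset.sum_congr rfl fun u _ => by ring

omit [MeasurableSpace Ω] [MeasurableSpace 𝒵] in
/-- The estimator is affine in the powers of the residual of the treatment. -/
theorem estimator_eq (I : Finset ℕ) (R : ℕ) (mom : ℕ → ℝ) (x a : 𝒵 → ℝ) (J : ℕ → ℕ → Ω → ℕ)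
    (ω : Ω) {G : ℕ → ℝ} (hG : G = fun q => M.residualPart i I R x J ω fun m =>
      (M.treated i m ω - a (M.Z m ω)) ^ q) :
    M.estimator i r k I R mom x a J ω = (1 / (I.card : ℝ)) * ∑ m ∈ I, x (M.Z m ω)
      + ((mom r)⁻¹ * G r + ∑ q ∈ Finset.Icc 1 (k - 1), coeffB mom r k q * (G q - mom q * G 0)) := by
  obtain ⟨c, hc⟩ := residualPart_eq (M := M) (i := i) I R x J ω
  have h : M.estimator i r k I R mom x a J ω = (1 / (I.card : ℝ)) * ∑ m ∈ I, x (M.Z m ω)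
      + M.residualPart i I R x J ω fun m => weightA mom r k (M.treated i m ω) (a (M.Z m ω)) := by
    rw [estimator, residualPart, add_assoc]
  rw [h, hG]
  simp only [hc, weightA, mul_add, Finset.sum_add_distrib]
  congr 2
  · rw [Finset.mul_sum]
    exact Finset.sum_congr rfl fun m _ => by ring
  · simp only [Finset.mul_sum]
    rw [Finset.sum_comm]
    refine Finset.sum_congr rfl fun q _ => ?_
    rw [← Finset.sum_sub_distrib, Finset.mul_sum]
    -- The constant `mom q` in the weight multiplies the zeroth power, hence the term `mom q * G 0`.
    exact Finset.sum_congr rfl fun m _ => by rw [pow_zero]; ring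

/-- Consistency of the estimator for arbitrary consistent estimates of the moments. -/
theorem TrainedNuisance.tendsto_estimator (T : M.TrainedNuisance μ i r k I Ic gTrain πTrain 𝒯)
    {R : ℕ → ℕ} (hR : ∀ N, 1 ≤ R N) {J : ℕ → ℕ → ℕ → Ω → ℕ}
    (hJ : ∀ N, M.IsResampling μ i (I N ∪ Ic N) (I N) (R N) (J N)) {mom : ℕ → Ω → ℕ → ℝ}
    (hmom : ∀ q ≤ r, TendstoInMeasure μ (fun N ω => mom N ω q) atTop fun _ => M.moment μ i q) :
    TendstoInMeasure μ (fun N ω => M.estimator i r k (I N) (R N) (mom N ω)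
        (M.trained (gTrain N) ω) (M.trained (πTrain N) ω) (J N) ω) atTop fun _ => M.θ μ i := by
  set G : ℕ → Ω → ℕ → ℝ := fun N ω q => M.residualPart i (I N) (R N) (M.trained (gTrain N) ω)
    (J N) ω fun m => (M.treated i m ω - M.trained (πTrain N) ω (M.Z m ω)) ^ q with hG
  -- Every power contributes zero in the limit, including `q = 0`, so the coefficients only need to
  -- have finite limits.
  have hG0 : ∀ q ≤ r, TendstoInMeasure μ (fun N ω => G N ω q) atTop fun _ => 0 := by
    intro q hq
    have h := (T.tendsto_average_residual hq).add_const_limits (T.tendsto_resampled hR hJ hq)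
    rw [add_zero] at h
    simpa only [hG, residualPart, T.card, sum_pool, mul_assoc] using h
  have hrk : k - 1 ≤ r := (Nat.sub_le _ _).trans T.le
  have h := T.tendsto_average_g.add_const_limits
    (((((hmom r le_rfl).inv_const_limit T.moment_ne).mul_const_limits (hG0 r le_rfl))).add_const_limits
      (tendstoInMeasure_finset_sum (s := Finset.Icc 1 (k - 1)) fun q hq =>
        (tendstoInMeasure_coeffB T.le T.moment_ne hmom q).mul_const_limits
          ((hG0 q ((Finset.mem_Icc.1 hq).2.trans hrk)).sub_const_limits
            ((hmom q ((Finset.mem_Icc.1 hq).2.trans hrk)).mul_const_limits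
              (hG0 0 (Nat.zero_le r))))))
  simp only [mul_zero, sub_zero, Finset.sum_const_zero, add_zero] at h
  refine TendstoInMeasure.congr_left (fun N => .of_forall fun ω => ?_) h
  dsimp only
  rw [estimator_eq (I N) (R N) (mom N ω) (M.trained (gTrain N) ω) (M.trained (πTrain N) ω) (J N) ω
    (G := G N ω) rfl, T.card N]

end CausalModel

theorem mainTheorem3 {Ω 𝒵 : Type*} [MeasurableSpace Ω] [MeasurableSpace 𝒵]
    (μ : Measure Ω) [IsProbabilityMeasure μ] {n : ℕ} (M : CausalModel Ω 𝒵 n) (i : Fin n)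
    (hM : M.Valid μ i)
    -- the orders of the score function
    (r k : ℕ) (hk : 2 ≤ k) (hkr : k ≤ r) (hmom : M.moment μ i r ≠ 0)
    -- the split of the data set into a sample of size `N` and a disjoint training sample
    (I Ic : ℕ → Finset ℕ) (hcard : ∀ N, (I N).card = N) (hdisj : ∀ N, Disjoint (I N) (Ic N))
    -- the training procedures
    (gTrain πTrain : (N : ℕ) → (Ic N → ℝ × Fin n × 𝒵) → 𝒵 → ℝ)
    (hg : ∀ N, Measurable (Function.uncurry (gTrain N)))
    (hπ : ∀ N, Measurable (Function.uncurry (πTrain N)))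
    -- the conditions on the nuisance parameters
    (𝒯 : Set ((𝒵 → ℝ) × (𝒵 → ℝ))) (h𝒯 : (M.g i, M.prop i) ∈ 𝒯)
    (hmem : ∀ N, ∀ᵐ ω ∂μ, (M.trained (gTrain N) ω, M.trained (πTrain N) ω) ∈ 𝒯)
    (hcons : M.FirstStageConsistent μ i k
      (fun N ω => M.trained (gTrain N) ω) (fun N ω => M.trained (πTrain N) ω))
    (hreg : M.MomentsRegular μ i r k 𝒯)
    -- the resampling
    (R : ℕ → ℕ) (hR : ∀ N, 1 ≤ R N) (J : ℕ → ℕ → ℕ → Ω → ℕ)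
    (hJ : ∀ N, M.IsResampling μ i (I N ∪ Ic N) (I N) (R N) (J N)) :
    TendstoInMeasure μ
      (fun N ω => M.estimator i r k (I N) (R N) (M.moment μ i)
        (M.trained (gTrain N) ω) (M.trained (πTrain N) ω) (J N) ω)
      atTop (fun _ => M.θ μ i) ∧
    TendstoInMeasure μ
      (fun N ω => M.estimator i r k (I N) (R N)
        (M.empiricalMoment i (I N) (M.trained (πTrain N) ω) ω)
        (M.trained (gTrain N) ω) (M.trained (πTrain N) ω) (J N) ω)
      atTop (fun _ => M.θ μ i) := by
  have T : M.TrainedNuisance μ i r k I Ic gTrain πTrain 𝒯 :=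
    ⟨hM, hk, hkr, hmom, hcard, hdisj, hg, hπ, hmem, hcons, hreg⟩
  refine ⟨T.tendsto_estimator hR hJ fun q _ => tendstoInMeasure_const _,
    T.tendsto_estimator hR hJ fun q hq => ?_⟩
  simpa only [CausalModel.empiricalMoment, hcard] using T.tendsto_average_pow hq
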